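/- Let $n\ge 4$, $1\le k\le n-3$, $\mu>0$, and let $\Omega\subset\mathbb R^n$ be a bounded domain (nonempty, open, connected). For a symmetric matrix $A$ let $\sigma_j(A)$ be the $j$-th elementary symmetric function of its eigenvalues. Let $u$ be a viscosity subsolution of $$\frac{\sigma_n}{\sigma_k}(D^2u)=\mu\quad\text{in }\Omega,$$ that is: $u$ is continuous and locally convex in $\Omega$ (convex on a ball around each point), and $\frac{\sigma_n}{\sigma_k}(D^2\varphi(y))\ge\mu$ whenever $y\in\Omega$, $\varphi\in C^2(\Omega)$, $\varphi(y)=u(y)$ and $\varphi\ge u$ in $\Omega$ (such a $\varphi$ has $D^2\varphi(y)\ge0$, and the quotient is read as $0$ where $\sigma_k(D^2\varphi(y))=0$). Suppose that one of the following holds: 1. $u\in C^{1,\alpha}(\overline\Omega)$ for some $\alpha$ with $1-\frac{2}{n-k}<\alpha\le1$; 2. $u\in W^{2,p}(\Omega)$ for some $p$ with $\frac{(n-1)(n-k)}{2}<p\le\infty$. Then $u$ is differentiable in $\Omega$ and its graph is strictly convex, i.e. $u$ is strictly convex on every convex subset of $\Omega$. Moreover, for every ball $B_R(x_0)\subseteq\Omega$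 and every $0<\rho\le\frac R4$, $$\min_{x\in\partial B_\rho(x_0)}\bigl(u(x)-u(x_0)-Du(x_0)\cdot(x-x_0)\bigr)\ge C>0,$$ where $C$ depends only on $n,k,\alpha,\mu,R,\rho$ and an upper bound for $\|u\|_{C^{1,\alpha}(\overline\Omega)}$ in case 1, and only on $n,k,p,\mu,R,\rho$ and an upper bound for $\|u\|_{W^{2,p}(\Omega)}$ in case 2. -/

import Mathlib

open MeasureTheory
open scoped ENNReal ContDiff

noncomputable section

/-- `ℝⁿ` with its Euclidean norm. -/
abbrev Rn (n : ℕ) : Type := EuclideanSpace ℝ (Fin n)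

/-- The `i`-th standard basis vector of `ℝⁿ`. -/
def stdVec {n : ℕ} (i : Fin n) : Rn n := EuclideanSpace.single i (1 : ℝ)

/-- A bounded domain: a nonempty, connected, bounded open set. -/
def IsBoundedDomain {n : ℕ} (Ω : Set (Rn n)) : Prop :=
  IsOpen Ω ∧ IsConnected Ω ∧ Bornology.IsBounded Ω

/-- The Hessian matrix `D²φ(x)`. -/
def hessian {n : ℕ} (φ : Rn n → ℝ) (x : Rn n) : Matrix (Fin n) (Fin n) ℝ :=
  Matrix.of fun i j => iteratedFDeriv ℝ 2 φ x ![stdVec i, stdVec j]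

/-- `σ_k(A)`: the `k`-th elementary symmetric function of the real eigenvalues of `A`, counted with
multiplicity. (It is used for symmetric `A`, all of whose `n` eigenvalues are real.) -/
def sigma {n : ℕ} (k : ℕ) (A : Matrix (Fin n) (Fin n) ℝ) : ℝ :=
  A.charpoly.roots.esymm k

/-- The Hessian quotient `(σ_n / σ_k)(A)`. A test function that touches a locally convex function
from above has a nonnegative Hessian `A`; if `σ_k(A) = 0` for such an `A`, then the quotient takes
the value `0` here, as its continuous extension to the nonnegative matrices does for `k < n`. -/
def hessianQuotient {n : ℕ} (k : ℕ) (A : Matrix (Fin n) (Fin n) ℝ) : ℝ :=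
  sigma n A / sigma k A

/-- Every point of `Ω` has a ball around it inside `Ω` on which `u` is convex. -/
def LocallyConvexOn {n : ℕ} (Ω : Set (Rn n)) (u : Rn n → ℝ) : Prop :=
  ∀ x ∈ Ω, ∃ r : ℝ, 0 < r ∧ Metric.ball x r ⊆ Ω ∧ ConvexOn ℝ (Metric.ball x r) u

/-- `u` is a viscosity subsolution of `(σ_n / σ_k)(D²u) = f` in `Ω`. By definition such a `u` is
continuous and locally convex in `Ω`. -/
def IsViscositySubsolution {n : ℕ} (k : ℕ) (Ω : Set (Rn n)) (f u : Rn n → ℝ) : Prop :=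
  ContinuousOn u Ω ∧ LocallyConvexOn Ω u ∧
    ∀ x₀ ∈ Ω, ∀ φ : Rn n → ℝ, ContDiffOn ℝ 2 φ Ω → φ x₀ = u x₀ → (∀ x ∈ Ω, u x ≤ φ x) →
      f x₀ ≤ hessianQuotient k (hessian φ x₀)

/-- The norm `sup |u| + sup |Du| + [Du]_α` over `Ω`, with values in `[0, ∞]`. -/
def c1AlphaNorm {n : ℕ} (Ω : Set (Rn n)) (α : ℝ) (u : Rn n → ℝ) : ℝ≥0∞ :=
  (⨆ x ∈ Ω, ENNReal.ofReal |u x|) + (⨆ x ∈ Ω, ENNReal.ofReal ‖fderiv ℝ u x‖) +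
    ⨆ x ∈ Ω, ⨆ y ∈ Ω, ENNReal.ofReal (‖fderiv ℝ u x - fderiv ℝ u y‖ / ‖x - y‖ ^ α)

/-- `u ∈ C^{1,α}(Ω̄)`: `u` is `C¹` in the open set `Ω`, `u` and `Du` extend continuously to the
closure of `Ω`, and the `C^{1,α}` norm is finite. -/
def MemC1Alpha {n : ℕ} (Ω : Set (Rn n)) (α : ℝ) (u : Rn n → ℝ) : Prop :=
  ContDiffOn ℝ 1 u Ω ∧
    (∃ v : Rn n → ℝ, ContinuousOn v (closure Ω) ∧ Set.EqOn v u Ω) ∧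
    (∃ V : Rn n → (Rn n →L[ℝ] ℝ), ContinuousOn V (closure Ω) ∧ Set.EqOn V (fderiv ℝ u) Ω) ∧
    c1AlphaNorm Ω α u < ⊤

/-- `g` is the weak partial derivative `∂ᵢ u` in the open set `Ω`. -/
def HasWeakPartial {n : ℕ} (Ω : Set (Rn n)) (i : Fin n) (u g : Rn n → ℝ) : Prop :=
  LocallyIntegrableOn u Ω ∧ LocallyIntegrableOn g Ω ∧
    ∀ φ : Rn n → ℝ, ContDiff ℝ ∞ φ → HasCompactSupport φ → tsupport φ ⊆ Ω →
      ∫ x in Ω, u x * fderiv ℝ φ x (stdVec i) = -∫ x in Ω, g x * φ x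

/-- `g i = ∂ᵢ u` and `h i j = ∂ⱼ ∂ᵢ u` weakly in `Ω`, for all `i` and `j`. -/
def HasWeakDerivs {n : ℕ} (Ω : Set (Rn n)) (u : Rn n → ℝ) (g : Fin n → Rn n → ℝ)
    (h : Fin n → Fin n → Rn n → ℝ) : Prop :=
  (∀ i, HasWeakPartial Ω i u (g i)) ∧ ∀ i j, HasWeakPartial Ω j (g i) (h i j)

/-- `u ∈ W^{2,p}(Ω)`: `u` and its weak derivatives up to order two are in `L^p(Ω)`. -/
def MemW2p {n : ℕ} (Ω : Set (Rn n)) (p : ℝ≥0∞) (u : Rn n → ℝ) : Prop :=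
  ∃ (g : Fin n → Rn n → ℝ) (h : Fin n → Fin n → Rn n → ℝ), HasWeakDerivs Ω u g h ∧
    MemLp u p (volume.restrict Ω) ∧ (∀ i, MemLp (g i) p (volume.restrict Ω)) ∧
    ∀ i j, MemLp (h i j) p (volume.restrict Ω)

/-- The `W^{2,p}(Ω)` norm: the sum of the `L^p(Ω)` norms of `u`, of its first and of its second weak
partial derivatives. The infimum runs over the representatives of the weak derivatives, all of
which give the same value; it is `∞` if the weak derivatives do not exist. -/
def w2pNorm {n : ℕ} (Ω : Set (Rn n)) (p : ℝ≥0∞) (u : Rn n → ℝ) : ℝ≥0∞ :=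
  ⨅ (g : Fin n → Rn n → ℝ) (h : Fin n → Fin n → Rn n → ℝ) (_ : HasWeakDerivs Ω u g h),
    eLpNorm u p (volume.restrict Ω) + ∑ i, eLpNorm (g i) p (volume.restrict Ω) +
      ∑ i, ∑ j, eLpNorm (h i j) p (volume.restrict Ω)

/-- The graph of `u` over `Ω` is strictly convex: `u` is strictly convex on every convex subset
of `Ω`. -/
def StrictlyConvexGraph {n : ℕ} (Ω : Set (Rn n)) (u : Rn n → ℝ) : Prop :=
  ∀ K : Set (Rn n), K ⊆ Ω → Convex ℝ K → StrictConvexOn ℝ K u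

/-- `u - u(x₀) - Du(x₀)·(x - x₀) ≥ C` on the sphere `∂B_ρ(x₀)`. -/
def SphereLowerBound {n : ℕ} (u : Rn n → ℝ) (x₀ : Rn n) (ρ C : ℝ) : Prop :=
  ∀ x ∈ Metric.sphere x₀ ρ, C ≤ u x - u x₀ - fderiv ℝ u x₀ (x - x₀)

end

/-! Let `ℓ` be the tangent affine function of `u` at `x₀` and `w = u - ℓ ≥ 0`. If `w < C` at some
point of the sphere of radius `ρ`, convexity gives `w ≤ C` on the whole segment from `x₀` to that
point. Regularity spreads this smallness sideways: with `C = δ ^ β`, one gets `w ≤ N = K δ ^ β` on a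
cylinder of radius `δ` and half-length `ρ / 4` around the middle of the segment.

A quadratic with second derivative `a ~ N / ρ²` along the segment and `b ~ N / δ²` across it, added
to `ℓ`, then touches `u` from above inside the cylinder up to a constant
(`IsViscositySubsolution.le_of_cylinder`). Its Hessian quotient is at most `a b ^ (n - 1 - k)`,
which is of order `δ ^ (β + (β - 2) (n - 1 - k))`. The exponent is positive exactly when `2 (n - 1 -
k) < β (n - k)`, so a small `δ` contradicts the subsolution property. As `δ` depends only on the
data, so does `C`.

In case 1, `β = 1 + α`, by comparing tangent planes at opposite points of the cylinder. In case 2,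
`β = 2 - (n - 1) / p`: the second differences of `u` are averaged over about `ρ / δ` disjoint balls
of radius comparable to `δ` along the segment. The averaging density is of order `δ ^ (1 - n) / ρ`,
and Hölder's inequality against `D²u ∈ L^p` loses only `δ ^ (-(n - 1) / p)`. These two values of `β`
turn the exponent condition into the stated thresholds.

Strict convexity follows by adding the sphere bounds at two opposite points. In case 2
differentiability comes from the same averaging estimate with a single ball, since the threshold for
`p` exceeds `n`. -/

/-! ### Hessian quotient of a matrix with one simple and one repeated eigenvalue. -/

open Polynomial in
theorem roots_charpoly_scalar_add_vecMulVec {n : ℕ} (hn : 1 ≤ n) (b d : ℝ) (e : Fin n → ℝ)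
    (he : e ⬝ᵥ e = 1) :
    (Matrix.scalar (Fin n) b + d • Matrix.vecMulVec e e).charpoly.roots =
      (b + d) ::ₘ Multiset.replicate (n - 1) b := by
  have h1 : Matrix.scalar (Fin n) b + d • Matrix.vecMulVec e e =
      Matrix.vecMulVec (d • e) e - Matrix.scalar (Fin n) (-b) := by
    rw [Matrix.smul_vecMulVec, map_neg, sub_neg_eq_add, add_comm]
  have h2 : (X ^ n - d • X ^ (n - 1) : ℝ[X]) = X ^ (n - 1) * (X - C d) := by
    obtain ⟨m, rfl⟩ := Nat.exists_eq_add_of_le' hn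
    rw [smul_eq_C_mul, Nat.add_sub_cancel]; ring
  have h3 : (Matrix.scalar (Fin n) b + d • Matrix.vecMulVec e e).charpoly =
      (X - C b) ^ (n - 1) * (X - C (b + d)) := by
    rw [h1, Matrix.charpoly_sub_scalar, Matrix.charpoly_vecMulVec, smul_dotProduct, he,
      Fintype.card_fin, smul_eq_mul, mul_one, h2]
    simp only [mul_comp, pow_comp, X_comp, sub_comp, C_comp, map_neg, map_add]
    ring
  rw [h3, roots_mul (mul_ne_zero (pow_ne_zero _ (X_sub_C_ne_zero _)) (X_sub_C_ne_zero _)),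
    roots_pow, roots_X_sub_C, roots_X_sub_C, Multiset.nsmul_singleton, add_comm,
    Multiset.singleton_add]

theorem Multiset.esymm_cons_succ {R : Type*} [CommSemiring R] (s : Multiset R) (a : R) (k : ℕ) :
    (a ::ₘ s).esymm (k + 1) = s.esymm (k + 1) + a * s.esymm k := by
  simp [Multiset.esymm, Multiset.powersetCard_cons, Multiset.sum_map_mul_left]

theorem Multiset.esymm_replicate {R : Type*} [CommSemiring R] (N k : ℕ) (b : R) :
    (Multiset.replicate N b).esymm k = N.choose k * b ^ k := by
  induction N generalizing k with
  | zero => cases k <;> simp [Multiset.esymm, Multiset.powersetCard_zero_right]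
  | succ N ih =>
    cases k with
    | zero => simp [Multiset.esymm]
    | succ k =>
      rw [Multiset.replicate_succ, Multiset.esymm_cons_succ, ih, ih, Nat.choose_succ_succ]
      push_cast; ring

/-- The eigenvalues are `a` once and `b` with multiplicity `n - 1`. Hence `σ_n = a b ^ (n - 1)`,
while `σ_k` contains the term `(n - 1).choose k * b ^ k ≥ b ^ k`. -/
theorem hessianQuotient_scalar_add_vecMulVec_le {n k : ℕ} (hk : 1 ≤ k) (hkn : k + 1 ≤ n)
    {a b : ℝ} (ha : 0 < a) (hb : 0 < b) (e : Fin n → ℝ) (he : e ⬝ᵥ e = 1) :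
    hessianQuotient k (Matrix.scalar (Fin n) b + (a - b) • Matrix.vecMulVec e e) ≤
      a * b ^ (n - 1 - k) := by
  obtain ⟨m, rfl⟩ := Nat.exists_eq_add_of_le' (show 1 ≤ n by omega)
  obtain ⟨l, rfl⟩ := Nat.exists_eq_add_of_le' hk
  have hr := roots_charpoly_scalar_add_vecMulVec (Nat.le_add_left 1 m) b (a - b) e he
  rw [add_sub_cancel, Nat.add_sub_cancel] at hr
  have hden : b ^ (l + 1) ≤ sigma (l + 1) (Matrix.scalar (Fin (m + 1)) b +
      (a - b) • Matrix.vecMulVec e e) := by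
    rw [sigma, hr, Multiset.esymm_cons_succ, Multiset.esymm_replicate, Multiset.esymm_replicate]
    have h1 : (1 : ℝ) ≤ (m.choose (l + 1) : ℝ) := by
      exact_mod_cast Nat.choose_pos (by omega)
    have h2 := le_mul_of_one_le_left (pow_pos hb (l + 1)).le h1
    have h3 : 0 ≤ a * ((m.choose l : ℝ) * b ^ l) := by positivity
    linarith
  have hnum : sigma (m + 1) (Matrix.scalar (Fin (m + 1)) b +
      (a - b) • Matrix.vecMulVec e e) = a * b ^ m := by
    rw [sigma, hr, Multiset.esymm_cons_succ, Multiset.esymm_replicate, Multiset.esymm_replicate]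
    simp
  have hpos := pow_pos hb (l + 1)
  rw [hessianQuotient, hnum, div_le_iff₀ (hpos.trans_le hden)]
  have h4 : b ^ m = b ^ (m + 1 - 1 - (l + 1)) * b ^ (l + 1) := by
    rw [← pow_add]; congr 1; omega
  rw [h4, ← mul_assoc]
  exact mul_le_mul_of_nonneg_left hden (by positivity)

/-! ### From global to local test functions. -/

open scoped Manifold in
/-- A continuous function on a bounded open set has a smooth majorant. -/
theorem exists_contDiffOn_majorant {E : Type*} [NormedAddCommGroup E] [NormedSpace ℝ E]
    [FiniteDimensional ℝ E] {Ω : Set E} (hΩ : IsOpen Ω) (hb : Bornology.IsBounded Ω) {u : E → ℝ}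
    (hu : ContinuousOn u Ω) :
    ∃ G : E → ℝ, ContDiffOn ℝ ∞ G Ω ∧ ∀ x ∈ Ω, u x ≤ G x := by
  have : ProperSpace E := FiniteDimensional.proper ℝ E
  obtain ⟨f, hsupp, hf, hrange⟩ := hΩ.exists_contDiff_support_eq (n := ⊤)
  have hpos : ∀ x ∈ Ω, 0 < f x := fun x hx =>
    lt_of_le_of_ne (hrange ⟨x, rfl⟩).1 (Ne.symm (by rw [← hsupp] at hx; exact hx))
  -- The majorant is sought as a function of `1 / f`, which tends to infinity at `∂Ω`. The part of
  -- `Ω` with `1 / f ≤ t + 1` is compact, so a constant works near each `t`; a partition of unity on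
  -- `ℝ` glues the constants.
  have hloc : ∀ t : ℝ, ∃ c, ∀ᶠ s in nhds t, c ∈ {c : ℝ | ∀ x ∈ Ω, (f x)⁻¹ = s → u x ≤ c} := by
    intro t
    have hsub : {x | 1 ≤ (t + 1) * f x} ⊆ Ω := by
      intro x hx
      rw [← hsupp, Function.mem_support]
      rintro h0
      rw [Set.mem_ofPred_eq, h0] at hx
      norm_num at hx
    have hK : IsCompact {x | 1 ≤ (t + 1) * f x} :=
      Metric.isCompact_of_isClosed_isBounded
        (isClosed_le continuous_const (continuous_const.mul hf.continuous)) (hb.subset hsub)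
    obtain ⟨c, hc⟩ := (hK.image_of_continuousOn (hu.mono hsub)).bddAbove
    refine ⟨c, ?_⟩
    filter_upwards [gt_mem_nhds (lt_add_one t)] with s hs x hx hxs
    refine hc ⟨x, ?_, rfl⟩
    have := hpos x hx
    have h1 : (f x)⁻¹ * f x = 1 := inv_mul_cancel₀ this.ne'
    rw [Set.mem_ofPred_eq, ← h1]
    gcongr
    linarith
  obtain ⟨g, hg⟩ := exists_contMDiffMap_forall_mem_convex_of_local_const (n := ⊤) 𝓘(ℝ, ℝ)
    (t := fun s : ℝ => {c : ℝ | ∀ x ∈ Ω, (f x)⁻¹ = s → u x ≤ c})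
    (fun s c hc d hd p q hp hq hpq x hx hxs => by
      have h1 := mul_le_mul_of_nonneg_left (hc x hx hxs) hp
      have h2 := mul_le_mul_of_nonneg_left (hd x hx hxs) hq
      have h3 : u x = p * u x + q * u x := by rw [← add_mul, hpq, one_mul]
      simp only [smul_eq_mul]; linarith) hloc
  refine ⟨fun x => g (f x)⁻¹, ?_, fun x hx => hg _ x hx rfl⟩
  exact g.contMDiff.contDiff.comp_contDiffOn
    (hf.contDiffOn.inv fun x hx => (hpos x hx).ne')

/-- The definition asks for test functions above `u` in all of `Ω`. A cutoff interpolates between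
the local `Q` and a smooth majorant of `u` without changing the Hessian at `y`. -/
theorem IsViscositySubsolution.le_hessianQuotient {n k : ℕ} {Ω : Set (Rn n)} {f u : Rn n → ℝ}
    (hu : IsViscositySubsolution k Ω f u) (hΩ : IsOpen Ω) (hb : Bornology.IsBounded Ω)
    {y : Rn n} (hy : y ∈ Ω) {Q : Rn n → ℝ} (hQ : ContDiff ℝ 2 Q) (hQy : Q y = u y)
    (hle : ∀ᶠ x in nhds y, u x ≤ Q x) : f y ≤ hessianQuotient k (hessian Q y) := by
  obtain ⟨G, hG, huG⟩ := exists_contDiffOn_majorant hΩ hb hu.1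
  obtain ⟨r, hr, hball⟩ := Metric.eventually_nhds_iff_ball.1 hle
  let χ : ContDiffBump y := ⟨r / 2, r, by positivity, by linarith⟩
  have hχ : ∀ᶠ x in nhds y, χ x = 1 := χ.eventuallyEq_one
  have heq : (fun x => χ x * Q x + (1 - χ x) * G x) =ᶠ[nhds y] Q := by
    filter_upwards [hχ] with x hx
    rw [hx]; ring
  have key := hu.2.2 y hy (fun x => χ x * Q x + (1 - χ x) * G x) ?_ ?_ ?_
  · convert key using 2
    ext i j
    simp only [hessian, Matrix.of_apply]
    rw [(heq.iteratedFDeriv ℝ 2).eq_of_nhds]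
  · exact (χ.contDiff.contDiffOn.mul hQ.contDiffOn).add
      ((contDiffOn_const.sub χ.contDiff.contDiffOn).mul (hG.of_le (by exact_mod_cast le_top)))
  · rw [← hQy]; exact heq.eq_of_nhds
  · intro x hx
    have h1 : χ x * u x ≤ χ x * Q x := by
      by_cases hxr : x ∈ Metric.ball y r
      · exact mul_le_mul_of_nonneg_left (hball x hxr) χ.nonneg
      · rw [χ.zero_of_le_dist (by simpa [χ] using hxr)]; simp
    have h2 := mul_le_mul_of_nonneg_left (huG x hx) (sub_nonneg.2 (χ.le_one (x := x)))
    linarith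

/-! ### The quadratic barrier on a thin cylinder. -/

theorem hasFDerivAt_inner_sub {n : ℕ} (e c x : Rn n) :
    HasFDerivAt (fun x : Rn n => (inner ℝ e (x - c) : ℝ)) (innerSL ℝ e) x := by
  have := (innerSL ℝ e).hasFDerivAt.comp x ((hasFDerivAt_id x).sub_const c)
  rwa [ContinuousLinearMap.comp_id] at this

theorem contDiff_affine_add_quadratic {n : ℕ} (a b p : ℝ) (L : Rn n →L[ℝ] ℝ) (c e : Rn n) :
    ContDiff ℝ 2 fun x =>
      p + L x + ((a - b) / 2 * (inner ℝ e (x - c)) ^ 2 + b / 2 * ‖x - c‖ ^ 2) := by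
  have h : ContDiff ℝ 2 fun x : Rn n => x - c := contDiff_id.sub contDiff_const
  exact (contDiff_const.add L.contDiff).add
    ((contDiff_const.mul ((contDiff_const.inner ℝ h).pow 2)).add
      (contDiff_const.mul (h.norm_sq ℝ)))

theorem hessian_affine_add_quadratic {n : ℕ} (a b p : ℝ) (L : Rn n →L[ℝ] ℝ) (c e x : Rn n) :
    hessian (fun x => p + L x + ((a - b) / 2 * (inner ℝ e (x - c)) ^ 2 + b / 2 * ‖x - c‖ ^ 2)) x =
      Matrix.scalar (Fin n) b + (a - b) • Matrix.vecMulVec e.ofLp e.ofLp := by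
  set Q := fun x => p + L x + ((a - b) / 2 * (inner ℝ e (x - c)) ^ 2 + b / 2 * ‖x - c‖ ^ 2)
  have hQ : ContDiff ℝ 2 Q := contDiff_affine_add_quadratic a b p L c e
  have h1 : ∀ x, HasFDerivAt Q
      (L + ((a - b) * inner ℝ e (x - c)) • innerSL ℝ e + b • innerSL ℝ (x - c)) x := by
    intro x
    refine ((L.hasFDerivAt.const_add p).add
      ((((hasFDerivAt_inner_sub e c x).pow 2).const_mul ((a - b) / 2)).add
      ((((hasFDerivAt_id x).sub_const c).norm_sq).const_mul (b / 2)))).congr_fderiv ?_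
    ext v
    simp
    ring
  have h2 : ∀ w, HasFDerivAt (fun x => fderiv ℝ Q x w)
      (((a - b) * inner ℝ e w) • innerSL ℝ e + b • innerSL ℝ w) x := by
    intro w
    have h3 : (fun x => fderiv ℝ Q x w) = fun x => L w + ((a - b) * inner ℝ e w) *
        inner ℝ e (x - c) + b * inner ℝ w (x - c) := by
      funext x
      rw [(h1 x).fderiv]
      simp only [add_apply, smul_apply, innerSL_apply_apply,
        smul_eq_mul]
      rw [real_inner_comm w (x - c)]
      ring
    rw [h3]
    exact (((hasFDerivAt_inner_sub e c x).const_mul _).const_add _).add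
      ((hasFDerivAt_inner_sub w c x).const_mul b)
  ext i j
  have h4 : DifferentiableAt ℝ (fderiv ℝ Q) x :=
    ((hQ.fderiv_right (m := 1) (by norm_num)).differentiable (by norm_num)).differentiableAt
  have h5 := (h2 (stdVec j)).fderiv
  rw [fderiv_clm_apply h4 (differentiableAt_const _)] at h5
  have h6 := DFunLike.congr_fun h5 (stdVec i)
  rw [hessian, Matrix.of_apply, iteratedFDeriv_two_apply]
  simp [stdVec, EuclideanSpace.inner_single_right] at h6 ⊢
  rw [h6]
  simp [Matrix.vecMulVec_apply, Matrix.diagonal_apply]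
  split_ifs <;> simp_all <;> ring

theorem norm_sq_sub_inner_smul {E : Type*} [NormedAddCommGroup E] [InnerProductSpace ℝ E]
    {e : E} (he : ‖e‖ = 1) (v : E) :
    ‖v - (inner ℝ e v : ℝ) • e‖ ^ 2 = ‖v‖ ^ 2 - (inner ℝ e v : ℝ) ^ 2 := by
  rw [norm_sub_sq_real, norm_smul, inner_smul_right, he, real_inner_comm, Real.norm_eq_abs, mul_one,
    sq_abs, real_inner_comm]
  ring

/-- Comparison with a quadratic on a thin ellipsoid: a subsolution that lies above an affine
function at the centre of a cylinder cannot be too close to that function on the cylinder. -/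
theorem IsViscositySubsolution.le_of_cylinder {n k : ℕ} (hk : 1 ≤ k) (hkn : k + 1 ≤ n) {μ : ℝ}
    {Ω : Set (Rn n)} {u : Rn n → ℝ} (hΩ : IsOpen Ω) (hb : Bornology.IsBounded Ω)
    (hu : IsViscositySubsolution k Ω (fun _ => μ) u) {c e : Rn n} (he : ‖e‖ = 1)
    {p r δ N : ℝ} {L : Rn n →L[ℝ] ℝ} (hr : 0 < r) (hδ : 0 < δ) (hN : 0 < N)
    (hsub : ∀ (s : ℝ) (y : Rn n), |s| ≤ r → ‖y‖ ≤ δ → c + s • e + y ∈ Ω)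
    (hc : p + L c ≤ u c)
    (hle : ∀ (s : ℝ) (y : Rn n), |s| ≤ r → ‖y‖ ≤ δ →
      u (c + s • e + y) ≤ p + L (c + s • e + y) + N) :
    μ ≤ 4 * N / r ^ 2 * (4 * N / δ ^ 2) ^ (n - 1 - k) := by
  -- These constants make `{q ≤ 2 N}` the ellipsoid with semi-axes `r` along `e` and `δ` across,
  -- which fits in the cylinder.
  set a := 4 * N / r ^ 2 with ha
  set b := 4 * N / δ ^ 2 with hb'
  have ha0 : 0 < a := by positivity
  have hb0 : 0 < b := by positivity
  set q : Rn n → ℝ := fun x => (a - b) / 2 * (inner ℝ e (x - c)) ^ 2 + b / 2 * ‖x - c‖ ^ 2 with hq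
  have hqc : Continuous q := by fun_prop
  have hq' : ∀ x, q x = a / 2 * (inner ℝ e (x - c)) ^ 2 +
      b / 2 * ‖(x - c) - (inner ℝ e (x - c) : ℝ) • e‖ ^ 2 := by
    intro x; rw [norm_sq_sub_inner_smul he]; simp only [hq]; ring
  have hcyl : ∀ x, q x ≤ 2 * N → ∃ (s : ℝ) (y : Rn n), |s| ≤ r ∧ ‖y‖ ≤ δ ∧ x = c + s • e + y := by
    intro x hx
    rw [hq'] at hx
    refine ⟨inner ℝ e (x - c), (x - c) - (inner ℝ e (x - c) : ℝ) • e, ?_, ?_, by abel⟩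
    · refine abs_le_of_sq_le_sq ?_ hr.le
      have h1 : a / 2 * (inner ℝ e (x - c)) ^ 2 ≤ a / 2 * r ^ 2 := by
        calc _ ≤ 2 * N := by
              have : 0 ≤ b / 2 * ‖(x - c) - (inner ℝ e (x - c) : ℝ) • e‖ ^ 2 := by positivity
              linarith
          _ = _ := by rw [ha]; field_simp; norm_num
      exact le_of_mul_le_mul_left h1 (by positivity)
    · refine le_of_sq_le_sq ?_ hδ.le
      have h1 : b / 2 * ‖(x - c) - (inner ℝ e (x - c) : ℝ) • e‖ ^ 2 ≤ b / 2 * δ ^ 2 := by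
        calc _ ≤ 2 * N := by
              have : 0 ≤ a / 2 * (inner ℝ e (x - c) : ℝ) ^ 2 := by positivity
              linarith
          _ = _ := by rw [hb']; field_simp; norm_num
      exact le_of_mul_le_mul_left h1 (by positivity)
  have hKΩ : {x | q x ≤ 2 * N} ⊆ Ω := by
    intro x hx
    obtain ⟨s, y, hs, hy, rfl⟩ := hcyl x hx
    exact hsub s y hs hy
  have hK : IsCompact {x | q x ≤ 2 * N} :=
    Metric.isCompact_of_isClosed_isBounded (isClosed_le hqc continuous_const) (hb.subset hKΩ)
  have hqc0 : q c = 0 := by simp [hq]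
  obtain ⟨y, hyK, hmin⟩ := hK.exists_isMinOn (f := fun x => p + L x + q x - u x)
    ⟨c, by rw [Set.mem_ofPred_eq, hqc0]; linarith⟩
    (((continuous_const.add L.continuous).add hqc).continuousOn.sub (hu.1.mono hKΩ))
  set m := p + L y + q y - u y with hm
  have hm0 : m ≤ 0 := by
    have := hmin (show c ∈ {x | q x ≤ 2 * N} by rw [Set.mem_ofPred_eq, hqc0]; linarith)
    simp only [Set.mem_ofPred_eq] at this
    rw [hqc0] at this
    linarith
  -- Where `q = 2 N`, the minimised function is at least `2 N - N > 0`, but its minimum is at most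
  -- its value at `c`, which is `≤ 0`. So the minimum is interior.
  have hy2 : q y < 2 * N := by
    refine lt_of_le_of_ne hyK fun h => ?_
    obtain ⟨s, z, hs, hz, hyz⟩ := hcyl y hyK
    have := hle s z hs hz
    rw [← hyz] at this
    linarith
  have key := hu.le_hessianQuotient hΩ hb (hKΩ hyK)
    (Q := fun x => p - m + L x +
      ((a - b) / 2 * (inner ℝ e (x - c)) ^ 2 + b / 2 * ‖x - c‖ ^ 2))
    (contDiff_affine_add_quadratic _ _ _ _ _ _)
    (by simp only [hm, hq]; ring) (by
      filter_upwards [(hqc.tendsto y).eventually_lt_const hy2] with x hx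
      have := hmin hx.le
      simp only [Set.mem_ofPred_eq, hq] at this
      simp only [hm, hq]; linarith)
  rw [hessian_affine_add_quadratic] at key
  refine key.trans (hessianQuotient_scalar_add_vecMulVec_le hk hkn ha0 hb0 _ ?_)
  have := EuclideanSpace.real_norm_sq_eq e
  rw [he] at this
  simp only [dotProduct, ← pow_two, ← this, one_pow]

/-- With `N = K δ ^ β` the barrier bound is a constant times `δ ^ (β + (β - 2) j)`, and `hβ` says
that this exponent is positive. -/
theorem exists_forall_lt_of_exponent {r K μ β : ℝ} (hμ : 0 < μ) (j : ℕ)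
    (hβ : 2 * (j : ℝ) < β * (j + 1)) :
    ∃ δ₀ : ℝ, 0 < δ₀ ∧ ∀ δ : ℝ, 0 < δ → δ < δ₀ →
      4 * (K * δ ^ β) / r ^ 2 * (4 * (K * δ ^ β) / δ ^ 2) ^ j < μ := by
  have hγ : 0 < β + (β - 2) * j := by linarith
  have ht : Filter.Tendsto (fun δ : ℝ => 4 * K / r ^ 2 * (4 * K) ^ j * δ ^ (β + (β - 2) * j))
      (nhds 0) (nhds 0) := by
    have := ((Real.continuousAt_rpow_const 0 _ (Or.inr hγ.le)).tendsto).const_mul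
      (4 * K / r ^ 2 * (4 * K) ^ j)
    rwa [Real.zero_rpow hγ.ne', mul_zero] at this
  obtain ⟨δ₀, h0, h⟩ := Metric.eventually_nhds_iff.1 (ht.eventually_lt_const hμ)
  refine ⟨δ₀, h0, fun δ hδ hlt => ?_⟩
  refine lt_of_eq_of_lt ?_ (h (y := δ) (by rwa [Real.dist_0_eq_abs, abs_of_pos hδ]))
  have h1 : 4 * (K * δ ^ β) / δ ^ 2 = 4 * K * δ ^ (β - 2) := by
    rw [Real.rpow_sub hδ, Real.rpow_two]; ring
  rw [h1, mul_pow, Real.rpow_add hδ, Real.rpow_mul hδ.le, Real.rpow_natCast]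
  ring

/-! ### Local convexity, supporting planes and strict convexity. -/

theorem LocallyConvexOn.convexOn {n : ℕ} {Ω : Set (Rn n)} {u : Rn n → ℝ}
    (hu : LocallyConvexOn Ω u) (hc : ContinuousOn u Ω) {K : Set (Rn n)} (hK : Convex ℝ K)
    (hKΩ : K ⊆ Ω) : ConvexOn ℝ K u := by
  refine ⟨hK, fun x hx y hy p q hp hq hpq => ?_⟩
  obtain rfl : p = 1 - q := by linarith
  set γ : ℝ → Rn n := fun t => x + t • (y - x) with hγ
  have hγK : ∀ t ∈ Set.Icc (0 : ℝ) 1, γ t ∈ K := fun t ht => by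
    have := hK hx hy (sub_nonneg.2 ht.2) ht.1 (by ring)
    convert this using 1
    simp only [hγ]; module
  set g : ℝ → ℝ := fun t => u (γ t) - ((1 - t) * u x + t * u y) with hg
  have hgc : ContinuousOn g (Set.Icc 0 1) := by
    refine ContinuousOn.sub (hc.comp (by fun_prop) fun t ht => hKΩ (hγK t ht)) (by fun_prop)
  have hg0 : g 0 = 0 := by simp [hg, hγ]
  have hg1 : g 1 = 0 := by simp [hg, hγ]
  obtain ⟨t₀, ht₀, hmax⟩ := isCompact_Icc.exists_isMaxOn (Set.nonempty_Icc.2 zero_le_one) hgc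
  have hgq : g q ≤ g t₀ := hmax ⟨hq, by linarith⟩
  suffices h : g t₀ ≤ 0 by
    have h1 : γ q = (1 - q) • x + q • y := by simp only [hγ]; module
    have h2 := hgq.trans h
    simp only [hg, h1] at h2
    simp only [smul_eq_mul]; linarith
  by_contra! hpos
  have hS : IsCompact {t ∈ Set.Icc (0 : ℝ) 1 | g t₀ ≤ g t} := by
    have : {t ∈ Set.Icc (0 : ℝ) 1 | g t₀ ≤ g t} = Set.Icc 0 1 ∩ g ⁻¹' Set.Ici (g t₀) := rfl
    rw [this]
    exact isCompact_Icc.of_isClosed_subset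
      (hgc.preimage_isClosed_of_isClosed isClosed_Icc isClosed_Ici) Set.inter_subset_left
  -- At the first maximiser of `u` minus its chord, the value a little to the left is strictly
  -- smaller and the value to the right is no larger. This contradicts midpoint convexity near that
  -- point.
  obtain ⟨t₁, ⟨ht₁, h1⟩, hleast⟩ := hS.exists_isLeast ⟨t₀, ht₀, le_rfl⟩
  have h10 : 0 < t₁ := lt_of_le_of_ne ht₁.1 fun h => by rw [← h, hg0] at h1; linarith
  have h11 : t₁ < 1 := lt_of_le_of_ne ht₁.2 fun h => by rw [h, hg1] at h1; linarith
  obtain ⟨r, hr, -, hconv⟩ := hu (γ t₁) (hKΩ (hγK t₁ ht₁))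
  have hγc : Continuous γ := by fun_prop
  obtain ⟨ε, hε, hball⟩ := Metric.continuousAt_iff.1 hγc.continuousAt r hr
  obtain ⟨s, hs0, hs⟩ : ∃ s : ℝ, 0 < s ∧ s < ε ∧ s ≤ t₁ ∧ s ≤ 1 - t₁ :=
    ⟨min (ε / 2) (min t₁ (1 - t₁)), by
      refine lt_min (by linarith) (lt_min h10 (by linarith)),
      (min_le_left _ _).trans_lt (by linarith), (min_le_right _ _).trans (min_le_left _ _),
      (min_le_right _ _).trans (min_le_right _ _)⟩
  have hm := hconv.2 (x := γ (t₁ - s)) (y := γ (t₁ + s))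
    (hball (by rw [Real.dist_eq]; simpa [abs_of_pos hs0] using hs.1))
    (hball (by rw [Real.dist_eq]; simpa [abs_of_pos hs0] using hs.1))
    (show (0 : ℝ) ≤ 1 / 2 by norm_num) (show (0 : ℝ) ≤ 1 / 2 by norm_num) (by norm_num)
  have hmid : (1 / 2 : ℝ) • γ (t₁ - s) + (1 / 2 : ℝ) • γ (t₁ + s) = γ t₁ := by
    simp only [hγ]; module
  rw [hmid] at hm
  have hminus : g (t₁ - s) < g t₀ := by
    by_contra! h
    have := hleast ⟨⟨by linarith, by linarith⟩, h⟩
    linarith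
  have hplus : g (t₁ + s) ≤ g t₀ := hmax ⟨by linarith, by linarith⟩
  simp only [smul_eq_mul] at hm
  simp only [hg] at h1 hminus hplus
  linarith

/-- Continuity makes the strict epigraph open, so Hahn–Banach separates it from `(x₀, u x₀)`. The
functional is negative in the vertical direction, and dividing by that component gives the slope. -/
theorem ConvexOn.exists_subgradient {E : Type*} [NormedAddCommGroup E] [NormedSpace ℝ E]
    {s : Set E} {u : E → ℝ} (hs : IsOpen s) (hu : ConvexOn ℝ s u) (hc : ContinuousOn u s)
    {x₀ : E} (hx₀ : x₀ ∈ s) : ∃ L : E →L[ℝ] ℝ, ∀ x ∈ s, u x₀ + L (x - x₀) ≤ u x := by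
  have hopen : IsOpen {p : E × ℝ | p.1 ∈ s ∧ u p.1 < p.2} := by
    rw [isOpen_iff_mem_nhds]
    rintro ⟨x, t⟩ ⟨hx, ht⟩
    have h1 : ContinuousAt (fun p : E × ℝ => u p.1) (x, t) :=
      ContinuousAt.comp (f := Prod.fst) (hc.continuousAt (hs.mem_nhds hx)) continuousAt_fst
    filter_upwards [continuousAt_fst.preimage_mem_nhds (hs.mem_nhds hx),
      h1.eventually_lt continuousAt_snd ht] with p hp1 hp2 using ⟨hp1, hp2⟩
  obtain ⟨f, hf⟩ := geometric_hahn_banach_open_point hu.convex_strict_epigraph hopen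
    (x := (x₀, u x₀)) (fun h => lt_irrefl _ h.2)
  set κ := f (0, 1) with hκ
  have hsplit : ∀ x t, f (x, t) = f (x, 0) + t * κ := fun x t => by
    rw [hκ, ← smul_eq_mul, ← map_smul, ← map_add]; simp
  have hκ0 : κ < 0 := by
    have := hf (x₀, u x₀ + 1) ⟨hx₀, lt_add_one _⟩
    rw [hsplit, hsplit x₀ (u x₀)] at this
    linarith
  refine ⟨(-κ)⁻¹ • f.comp (ContinuousLinearMap.inl ℝ E ℝ), fun x hx => ?_⟩
  have h2 : f (x, 0) + u x * κ ≤ f (x₀, 0) + u x₀ * κ := by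
    refine le_of_forall_pos_le_add fun ε hε => ?_
    have := hf (x, u x + ε / (-κ)) ⟨hx, lt_add_of_pos_right _ (div_pos hε (by linarith))⟩
    rw [hsplit, hsplit x₀] at this
    have h3 : ε / (-κ) * κ = -ε   := by
      rw [div_neg, neg_mul, div_mul_cancel₀ _ hκ0.ne]
    rw [add_mul, h3] at this
    linarith
  have h4 : f (x - x₀, 0) = f (x, 0) - f (x₀, 0) := by
    rw [← map_sub]; simp
  have h5 : (-κ) * ((-κ)⁻¹ * f (x - x₀, 0)) = f (x - x₀, 0) :=
    mul_inv_cancel_left₀ (by linarith) _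
  simp only [smul_apply, ContinuousLinearMap.comp_apply,
    ContinuousLinearMap.inl_apply, smul_eq_mul]
  refine le_of_mul_le_mul_left ?_ (show 0 < -κ by linarith)
  rw [mul_add, h5, h4]
  linarith

theorem ConvexOn.add_fderiv_le {E : Type*} [NormedAddCommGroup E] [NormedSpace ℝ E]
    {s : Set E} {u : E → ℝ} (hs : IsOpen s) (hu : ConvexOn ℝ s u) (hc : ContinuousOn u s)
    {x₀ : E} (hx₀ : x₀ ∈ s) (hd : DifferentiableAt ℝ u x₀) {x : E} (hx : x ∈ s) :
    u x₀ + fderiv ℝ u x₀ (x - x₀) ≤ u x := by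
  obtain ⟨L, hL⟩ := hu.exists_subgradient hs hc hx₀
  have hmin : IsLocalMin (fun x => u x - L x) x₀ := by
    filter_upwards [hs.mem_nhds hx₀] with y hy
    have := hL y hy
    rw [map_sub] at this
    linarith
  have h1 := hmin.hasFDerivAt_eq_zero (hd.hasFDerivAt.sub L.hasFDerivAt)
  rw [sub_eq_zero.1 h1]
  exact hL x hx

/-- If equality held at `z`, convexity would give `u (z + v) + u (z - v) ≤ 2 u z` for small `v`
along the segment. The sphere bounds at `z ± v` add up to the reverse with a gain of `2 C`, since
the linear terms cancel. -/
theorem strictlyConvexGraph_of_sphereLowerBound {n : ℕ} {Ω : Set (Rn n)} {u : Rn n → ℝ}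
    (hΩ : IsOpen Ω) (hu : LocallyConvexOn Ω u) (hc : ContinuousOn u Ω)
    (hlow : ∀ x₀ R, 0 < R → Metric.ball x₀ R ⊆ Ω → ∀ ρ, 0 < ρ → ρ ≤ R / 4 →
      ∃ C, 0 < C ∧ SphereLowerBound u x₀ ρ C) :
    StrictlyConvexGraph Ω u := by
  intro K hKΩ hK
  have hconv := hu.convexOn hc hK hKΩ
  refine ⟨hK, fun x hx y hy hxy p q hp hq hpq => ?_⟩
  refine lt_of_le_of_ne (hconv.2 hx hy hp.le hq.le hpq) fun heq => ?_
  obtain rfl : q = 1 - p := by linarith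
  set z := p • x + (1 - p) • y with hz
  have hzΩ : z ∈ Ω := hKΩ (hK hx hy hp.le hq.le hpq)
  obtain ⟨R, hR, hball⟩ := Metric.isOpen_iff.1 hΩ z hzΩ
  have hyx : 0 < ‖y - x‖ := norm_pos_iff.2 (sub_ne_zero.2 hxy.symm)
  obtain ⟨t, ht0, htp, htq, htR⟩ : ∃ t : ℝ, 0 < t ∧ t ≤ p ∧ t ≤ 1 - p ∧ t * ‖y - x‖ ≤ R / 4 :=
    ⟨min (min p (1 - p)) (R / 4 / ‖y - x‖), lt_min (lt_min hp hq) (by positivity),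
      (min_le_left _ _).trans (min_le_left _ _), (min_le_left _ _).trans (min_le_right _ _),
      (le_div_iff₀ hyx).1 (min_le_right _ _)⟩
  obtain ⟨C, hC, hlow⟩ := hlow z R hR hball (t * ‖y - x‖) (by positivity) htR
  have h1 := hlow (z + t • (y - x)) (by simp [norm_smul, abs_of_pos ht0])
  have h2 := hlow (z - t • (y - x)) (by simp [norm_smul, abs_of_pos ht0])
  have h3 := hconv.2 hx hy (show 0 ≤ p - t by linarith) (show 0 ≤ 1 - p + t by linarith) (by ring)
  have h4 := hconv.2 hx hy (show 0 ≤ p + t by linarith) (show 0 ≤ 1 - p - t by linarith) (by ring)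
  rw [show (p - t) • x + (1 - p + t) • y = z + t • (y - x) by rw [hz]; module] at h3
  rw [show (p + t) • x + (1 - p - t) • y = z - t • (y - x) by rw [hz]; module] at h4
  rw [add_sub_cancel_left] at h1
  rw [sub_sub_cancel_left, map_neg] at h2
  simp only [smul_eq_mul] at h3 h4 heq
  linarith

/-! ### Reduction of the sphere bound to a growth estimate. -/

/-- The sphere bound follows from a growth bound along the segments from `x₀` to those points of
the sphere at which the bound is violated. -/
theorem IsViscositySubsolution.sphereLowerBound_of_growth {n k : ℕ} (hk : 1 ≤ k) (hkn : k + 1 ≤ n)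
    {μ : ℝ} {Ω : Set (Rn n)} {u : Rn n → ℝ} (hΩ : IsBoundedDomain Ω)
    (hu : IsViscositySubsolution k Ω (fun _ => μ) u) {x₀ : Rn n} {R ρ δ N C : ℝ} (hρ : 0 < ρ)
    (hρR : ρ ≤ R / 4) (hball : Metric.ball x₀ R ⊆ Ω) (hd : DifferentiableAt ℝ u x₀)
    (hδ : 0 < δ) (hδR : δ ≤ R / 4) (hN : 0 < N)
    (hlt : 4 * N / (ρ / 4) ^ 2 * (4 * N / δ ^ 2) ^ (n - 1 - k) < μ)
    (hgrowth : ∀ e : Rn n, ‖e‖ = 1 → (∀ s : ℝ, 0 ≤ s → s ≤ ρ →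
        u (x₀ + s • e) - u x₀ - fderiv ℝ u x₀ (s • e) ≤ C) →
      ∀ (s : ℝ) (y : Rn n), |s| ≤ ρ / 4 → ‖y‖ ≤ δ →
        u (x₀ + (ρ / 2 + s) • e + y) - u x₀ - fderiv ℝ u x₀ ((ρ / 2 + s) • e + y) ≤ N) :
    SphereLowerBound u x₀ ρ C := by
  intro x hx
  by_contra! hC
  have hconv := hu.2.1.convexOn hu.1 (convex_ball x₀ R) hball
  have hcont := hu.1.mono hball
  have hR : 0 < R := by linarith
  have hx₀ : x₀ ∈ Metric.ball x₀ R := Metric.mem_ball_self hR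
  have htan : ∀ z, ‖z‖ < R → 0 ≤ u (x₀ + z) - u x₀ - fderiv ℝ u x₀ z := fun z hz => by
    have := hconv.add_fderiv_le Metric.isOpen_ball hcont hx₀ hd (x := x₀ + z) (by simpa using hz)
    rw [add_sub_cancel_left] at this
    linarith
  have hxρ : ‖x - x₀‖ = ρ := by rwa [← dist_eq_norm]
  set e := ρ⁻¹ • (x - x₀) with he_def
  have hρe : ρ • e = x - x₀ := by rw [he_def, smul_inv_smul₀ hρ.ne']
  have he : ‖e‖ = 1 := by
    rw [he_def, norm_smul, hxρ, norm_inv, Real.norm_of_nonneg hρ.le, inv_mul_cancel₀ hρ.ne']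
  have hnonneg : 0 ≤ C := by
    have := htan (x - x₀) (by rw [hxρ]; linarith)
    rw [add_sub_cancel] at this
    linarith
  have hseg : ∀ s : ℝ, 0 ≤ s → s ≤ ρ →
      u (x₀ + s • e) - u x₀ - fderiv ℝ u x₀ (s • e) ≤ C := by
    intro s hs0 hs1
    have hsρ : s / ρ ≤ 1 := (div_le_one hρ).2 hs1
    have h0 : 0 ≤ s / ρ := by positivity
    have hxB : x ∈ Metric.ball x₀ R := by rw [Metric.mem_ball, dist_eq_norm, hxρ]; linarith
    have := hconv.2 hx₀ hxB (sub_nonneg.2 hsρ) h0 (by ring)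
    have hse : s • e = (s / ρ) • (x - x₀) := by rw [he_def, smul_smul]; rfl
    rw [show (1 - s / ρ) • x₀ + (s / ρ) • x = x₀ + s • e by rw [hse]; module] at this
    rw [hse, map_smul, ← hse]
    simp only [smul_eq_mul] at this ⊢
    have h1 := mul_le_mul_of_nonneg_left hC.le h0
    have h2 := mul_le_mul_of_nonneg_right hsρ hnonneg
    linarith
  have hin : ∀ (s : ℝ) (y : Rn n), |s| ≤ ρ / 4 → ‖y‖ ≤ δ → ‖(ρ / 2 + s) • e + y‖ < R := by
    intro s y hs hy
    have h1 := norm_add_le ((ρ / 2 + s) • e) y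
    rw [norm_smul, he, mul_one, Real.norm_eq_abs] at h1
    have h2 := abs_add_le (ρ / 2) s
    rw [abs_of_pos (show 0 < ρ / 2 by positivity)] at h2
    linarith
  have hsplit : ∀ (s : ℝ) (y : Rn n), x₀ + (ρ / 2) • e + s • e + y =
      x₀ + ((ρ / 2 + s) • e + y) := fun s y => by module
  -- The cylinder is centred at the midpoint of the segment; its half-length `ρ / 4` keeps its axis
  -- away from both ends.
  refine hlt.not_ge (hu.le_of_cylinder hk hkn hΩ.1 hΩ.2.2 (c := x₀ + (ρ / 2) • e) he
    (p := u x₀ - fderiv ℝ u x₀ x₀) (L := fderiv ℝ u x₀) (by positivity) hδ hN ?_ ?_ ?_)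
  · intro s y hs hy
    rw [hsplit]
    exact hball (by simpa using hin s y hs hy)
  · have := htan ((ρ / 2) • e) (by
      have := hin 0 0 (by simpa using (show 0 ≤ ρ / 4 by positivity)) (by simpa using hδ.le)
      simpa using this)
    rw [map_add]
    linarith
  · intro s y hs hy
    have := hgrowth e he hseg s y hs hy
    rw [hsplit, map_add, ← add_assoc]
    linarith

/-! ### Case 1: Hölder continuous gradient. -/

theorem norm_fderiv_sub_le_of_c1AlphaNorm_le {n : ℕ} {Ω : Set (Rn n)} {α M : ℝ} {u : Rn n → ℝ}
    (hα : 0 < α) (hM : c1AlphaNorm Ω α u ≤ ENNReal.ofReal M) {x y : Rn n} (hx : x ∈ Ω)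
    (hy : y ∈ Ω) : ‖fderiv ℝ u x - fderiv ℝ u y‖ ≤ max M 0 * ‖x - y‖ ^ α := by
  rcases eq_or_ne x y with rfl | hxy
  · simp [Real.zero_rpow hα.ne']
  have h1 : ENNReal.ofReal (‖fderiv ℝ u x - fderiv ℝ u y‖ / ‖x - y‖ ^ α) ≤ ENNReal.ofReal M :=
    ((le_iSup₂ (f := fun y (_ : y ∈ Ω) => ENNReal.ofReal
        (‖fderiv ℝ u x - fderiv ℝ u y‖ / ‖x - y‖ ^ α)) y hy).trans
      (le_iSup₂ (f := fun x (_ : x ∈ Ω) => ⨆ y ∈ Ω, ENNReal.ofReal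
        (‖fderiv ℝ u x - fderiv ℝ u y‖ / ‖x - y‖ ^ α)) x hx)).trans
      (le_add_self.trans hM)
  have hpos : 0 < ‖x - y‖ ^ α := Real.rpow_pos_of_pos (norm_pos_iff.2 (sub_ne_zero.2 hxy)) _
  rw [← div_le_iff₀ hpos]
  rw [ENNReal.ofReal_le_ofReal_iff'] at h1
  rcases h1 with h | h
  · exact h.trans (le_max_left _ _)
  · exact h.trans (le_max_right _ _)

/-- For `w = u - ℓ` and `z` on the segment, convexity gives `w (z + y) ≤ w z + Dw (z + y) y` and `Dw
(z - y) y ≤ w z - w (z - y) ≤ w z`. Hence `w (z + y) ≤ 2 w z + (Du (z + y) - Du (z - y)) y`, and the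
last term is `O(δ ^ (1 + α))`. -/
theorem exists_sphereLowerBound_of_c1AlphaNorm_le {n k : ℕ} (hk : 1 ≤ k) (hkn : k + 1 ≤ n)
    {μ : ℝ} (hμ : 0 < μ) {α : ℝ} (hα : 0 < α)
    (hexp : 2 * ((n - 1 - k : ℕ) : ℝ) < (1 + α) * ((n - 1 - k : ℕ) + 1)) {R ρ M : ℝ} (hρ : 0 < ρ)
    (hρR : ρ ≤ R / 4) : ∃ C : ℝ, 0 < C ∧
      ∀ (Ω : Set (Rn n)) (u : Rn n → ℝ) (x₀ : Rn n), IsBoundedDomain Ω →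
        IsViscositySubsolution k Ω (fun _ => μ) u → DifferentiableOn ℝ u Ω →
        c1AlphaNorm Ω α u ≤ ENNReal.ofReal M → Metric.ball x₀ R ⊆ Ω →
          SphereLowerBound u x₀ ρ C := by
  obtain ⟨δ₀, hδ₀, hlt⟩ := exists_forall_lt_of_exponent (r := ρ / 4)
    (K := 2 + max M 0 * 2 ^ α) hμ (n - 1 - k) hexp
  obtain ⟨δ, hδ, hδδ₀, hδR⟩ : ∃ δ : ℝ, 0 < δ ∧ δ < δ₀ ∧ δ ≤ R / 4 :=
    ⟨min (δ₀ / 2) (R / 4), lt_min (by linarith) (by linarith),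
      (min_le_left _ _).trans_lt (by linarith), min_le_right _ _⟩
  refine ⟨δ ^ (1 + α), by positivity, fun Ω u x₀ hΩ hu hd hM hball => ?_⟩
  have hconv := hu.2.1.convexOn hu.1 (convex_ball x₀ R) hball
  have hcont := hu.1.mono hball
  have hR : 0 < R := by linarith
  have hx₀ : x₀ ∈ Metric.ball x₀ R := Metric.mem_ball_self hR
  have hdiff : ∀ z ∈ Metric.ball x₀ R, DifferentiableAt ℝ u z := fun z hz =>
    hd.differentiableAt (hΩ.1.mem_nhds (hball hz))
  have htan : ∀ z ∈ Metric.ball x₀ R, ∀ z' ∈ Metric.ball x₀ R,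
      u z + fderiv ℝ u z (z' - z) ≤ u z' := fun z hz z' hz' =>
    hconv.add_fderiv_le Metric.isOpen_ball hcont hz (hdiff z hz) hz'
  refine hu.sphereLowerBound_of_growth hk hkn hΩ hρ hρR hball (hdiff x₀ hx₀) hδ hδR (by positivity)
    (hlt δ hδ hδδ₀) fun e he hseg s y hs hy => ?_
  have hs' := abs_le.1 hs
  set z := (ρ / 2 + s) • e with hz
  have hzn : ‖z‖ ≤ 3 * ρ / 4 := by
    rw [hz, norm_smul, he, mul_one, Real.norm_of_nonneg (by linarith)]; linarith
  have hz0 : x₀ + z ∈ Metric.ball x₀ R := by simp; linarith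
  have hzp : x₀ + z + y ∈ Metric.ball x₀ R := by
    have := norm_add_le z y
    rw [Metric.mem_ball, dist_eq_norm, add_assoc, add_sub_cancel_left]; linarith
  have hzm : x₀ + z - y ∈ Metric.ball x₀ R := by
    have := norm_sub_le z y
    rw [Metric.mem_ball, dist_eq_norm, add_sub_assoc, add_sub_cancel_left]; linarith
  have h1 := htan _ hzp _ hz0
  have h2 := htan _ hzm _ hz0
  have h3 := htan _ hx₀ _ hzm
  have h4 := hseg (ρ / 2 + s) (by linarith) (by linarith)
  rw [← hz] at h4
  rw [show x₀ + z - (x₀ + z + y) = -y by abel, map_neg] at h1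
  rw [show x₀ + z - (x₀ + z - y) = y by abel] at h2
  rw [show x₀ + z - y - x₀ = z - y by abel, map_sub] at h3
  have h5 : fderiv ℝ u (x₀ + z + y) y - fderiv ℝ u (x₀ + z - y) y ≤
      max M 0 * 2 ^ α * δ ^ (1 + α) := by
    have h6 := norm_fderiv_sub_le_of_c1AlphaNorm_le hα hM (hball hzp) (hball hzm)
    have h7 := (fderiv ℝ u (x₀ + z + y) - fderiv ℝ u (x₀ + z - y)).le_opNorm y
    have h8 : ‖x₀ + z + y - (x₀ + z - y)‖ ≤ 2 * δ := by
      rw [show x₀ + z + y - (x₀ + z - y) = (2 : ℝ) • y by module, norm_smul]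
      norm_num; exact hy
    have h9 : ‖x₀ + z + y - (x₀ + z - y)‖ ^ α ≤ 2 ^ α * δ ^ α := by
      rw [← Real.mul_rpow (by norm_num) hδ.le]
      exact Real.rpow_le_rpow (norm_nonneg _) h8 hα.le
    calc _ ≤ ‖(fderiv ℝ u (x₀ + z + y) - fderiv ℝ u (x₀ + z - y)) y‖ := le_abs_self _
      _ ≤ max M 0 * (2 ^ α * δ ^ α) * δ := by
        refine h7.trans (mul_le_mul (h6.trans ?_) hy (norm_nonneg _) (by positivity))
        exact mul_le_mul_of_nonneg_left h9 (le_max_right _ _)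
      _ = _ := by rw [Real.rpow_add hδ, Real.rpow_one]; ring
  rw [map_add]
  linarith

/-! ### Averaged second differences of a convex function. -/

theorem second_difference_le_of_hasDerivAt {g g₁ g₂ : ℝ → ℝ} {K τ : ℝ} (hτ : 0 ≤ τ)
    (h1 : ∀ t, HasDerivAt g (g₁ t) t) (h2 : ∀ t, HasDerivAt g₁ (g₂ t) t)
    (hK : ∀ t, |t| ≤ τ → g₂ t ≤ K) : g τ + g (-τ) - 2 * g 0 ≤ K * τ ^ 2 := by
  have hd1 : ∀ t, HasDerivAt (fun t => g₁ t - g₁ (-t) - 2 * K * t) (g₂ t + g₂ (-t) - 2 * K) t := by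
    intro t
    have h := (h2 (-t)).comp t (hasDerivAt_neg t)
    refine (((h2 t).sub h).sub ((hasDerivAt_id t).const_mul (2 * K))).congr_deriv ?_
    ring
  have hd0 : ∀ t, HasDerivAt (fun t => g t + g (-t) - 2 * g 0 - K * t ^ 2)
      (g₁ t - g₁ (-t) - 2 * K * t) t := by
    intro t
    have h := (h1 (-t)).comp t (hasDerivAt_neg t)
    refine ((((h1 t).add h).sub_const (2 * g 0)).sub ((hasDerivAt_pow 2 t).const_mul K)).congr_deriv
      ?_
    simp; ring
  have ha1 : AntitoneOn (fun t => g₁ t - g₁ (-t) - 2 * K * t) (Set.Icc 0 τ) := by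
    refine antitoneOn_of_deriv_nonpos (convex_Icc 0 τ)
      (fun t _ => (hd1 t).continuousAt.continuousWithinAt)
      (fun t _ => (hd1 t).differentiableAt.differentiableWithinAt) fun t ht => ?_
    rw [interior_Icc] at ht
    rw [(hd1 t).deriv]
    have := hK t (by rw [abs_of_pos ht.1]; exact ht.2.le)
    have := hK (-t) (by rw [abs_neg, abs_of_pos ht.1]; exact ht.2.le)
    linarith
  have ha0 : AntitoneOn (fun t => g t + g (-t) - 2 * g 0 - K * t ^ 2) (Set.Icc 0 τ) := by
    refine antitoneOn_of_deriv_nonpos (convex_Icc 0 τ)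
      (fun t _ => (hd0 t).continuousAt.continuousWithinAt)
      (fun t _ => (hd0 t).differentiableAt.differentiableWithinAt) fun t ht => ?_
    rw [interior_Icc] at ht
    rw [(hd0 t).deriv]
    have := ha1 (Set.left_mem_Icc.2 hτ) (Set.Ioo_subset_Icc_self ht) ht.1.le
    simp only [neg_zero, sub_self, mul_zero] at this
    exact this
  have := ha0 (Set.left_mem_Icc.2 hτ) (Set.right_mem_Icc.2 hτ) hτ
  simp only [neg_zero] at this
  nlinarith

/-- Hölder's inequality against a bounded probability density. -/
theorem integral_mul_le_of_density {X : Type*} [MeasurableSpace X] {ν : Measure X} [IsFiniteMeasure ν]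
    {p : ℝ}
    (hp : 1 < p) {f θ : X → ℝ} {A : ℝ} (hf : MemLp f (ENNReal.ofReal p) ν) (hθi : Integrable θ ν)
    (hθ0 : ∀ x, 0 ≤ θ x) (hθA : ∀ x, θ x ≤ A) (hθ1 : ∫ x, θ x ∂ν ≤ 1) :
    ∫ x, f x * θ x ∂ν ≤ A ^ (1 / p) * (eLpNorm f (ENNReal.ofReal p) ν).toReal := by
  rcases isEmpty_or_nonempty X with hX | ⟨⟨x₀⟩⟩
  · simp [Measure.eq_zero_of_isEmpty ν]
  have hA : 0 ≤ A := (hθ0 x₀).trans (hθA x₀)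
  have hpq := Real.HolderConjugate.conjExponent hp
  set q := p.conjExponent
  have hq0 : 0 < q := hpq.symm.pos
  have hp0 : 0 < p := hpq.pos
  have hθp : MemLp θ (ENNReal.ofReal q) ν :=
    MemLp.of_bound hθi.aestronglyMeasurable A (Filter.Eventually.of_forall fun x => by
      rw [Real.norm_of_nonneg (hθ0 x)]; exact hθA x)
  have hnorm : (∫ x, |f x| ^ p ∂ν) ^ (1 / p) = (eLpNorm f (ENNReal.ofReal p) ν).toReal := by
    rw [hf.eLpNorm_eq_integral_rpow_norm (by simpa using hp0) ENNReal.ofReal_ne_top,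
      ENNReal.toReal_ofReal (by positivity), ENNReal.toReal_ofReal hp0.le, one_div]
    rfl
  -- This interpolation between the sup bound and the unit mass yields `‖θ‖_q ≤ A ^ ((q - 1) / q) =
  -- A ^ (1 / p)`.
  have hpow : ∀ x, θ x ^ q ≤ A ^ (q - 1) * θ x := by
    intro x
    rcases (hθ0 x).eq_or_lt with h | h
    · rw [← h, Real.zero_rpow hq0.ne', mul_zero]
    · have : θ x ^ q = θ x ^ (q - 1) * θ x := by
        rw [Real.rpow_sub h, Real.rpow_one, div_mul_cancel₀ _ h.ne']
      rw [this]
      exact mul_le_mul_of_nonneg_right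
        (Real.rpow_le_rpow h.le (hθA x) (by linarith [hpq.symm.lt])) h.le
  have hθq : (∫ x, θ x ^ q ∂ν) ^ (1 / q) ≤ A ^ (1 / p) := by
    have h1 : ∫ x, θ x ^ q ∂ν ≤ A ^ (q - 1) := by
      refine (integral_mono_of_nonneg (Filter.Eventually.of_forall fun x =>
        Real.rpow_nonneg (hθ0 x) _) (hθi.const_mul _) (Filter.Eventually.of_forall hpow)).trans ?_
      rw [integral_const_mul]
      exact mul_le_of_le_one_right (by positivity) hθ1
    refine (Real.rpow_le_rpow (integral_nonneg fun x => Real.rpow_nonneg (hθ0 x) _) h1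
      (by positivity)).trans_eq ?_
    rw [← Real.rpow_mul hA]
    congr 1
    have := hpq.inv_add_inv_eq_one
    rw [one_div, one_div, sub_mul, mul_inv_cancel₀ hq0.ne']
    linarith
  calc ∫ x, f x * θ x ∂ν ≤ ∫ x, |f x| * θ x ∂ν := by
        have := hpq.ennrealOfReal
        have hint : Integrable (fun x => f x * θ x) ν := hf.integrable_mul hθp
        have hint' : Integrable (fun x => |f x| * θ x) ν := hf.abs.integrable_mul hθp
        exact integral_mono hint hint' fun x =>
          mul_le_mul_of_nonneg_right (le_abs_self _) (hθ0 x)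
    _ ≤ (∫ x, |f x| ^ p ∂ν) ^ (1 / p) * (∫ x, θ x ^ q ∂ν) ^ (1 / q) :=
        integral_mul_le_Lp_mul_Lq_of_nonneg hpq (Filter.Eventually.of_forall fun x => abs_nonneg _)
          (Filter.Eventually.of_forall hθ0) hf.abs hθp
    _ ≤ _ := by
        rw [hnorm, mul_comm]
        exact mul_le_mul_of_nonneg_right hθq ENNReal.toReal_nonneg

/-- The left side is the second difference of the smooth function `U * Θ` at `x`. Its second
derivative along `v` moves onto `U` by the weak identity and becomes the integral of `f` against a
translated and reflected `Θ`, a density bounded by `A`. -/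
theorem integral_second_difference_le {n : ℕ} {B : Set (Rn n)}
    (hBf : volume B ≠ ⊤) {U f : Rn n → ℝ} {v : Rn n} {p A τ : ℝ} (hU : Continuous U) (hp : 1 < p)
    (hf : MemLp f (ENNReal.ofReal p) (volume.restrict B))
    (hweak : ∀ φ : Rn n → ℝ, ContDiff ℝ ∞ φ → HasCompactSupport φ → tsupport φ ⊆ B →
      ∫ x, U x * fderiv ℝ (fun z => fderiv ℝ φ z v) x v = ∫ x in B, f x * φ x)
    {Θ : Rn n → ℝ} (hΘ : ContDiff ℝ ∞ Θ) (hΘc : HasCompactSupport Θ) (hΘ0 : ∀ x, 0 ≤ Θ x)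
    (hΘA : ∀ x, Θ x ≤ A) (hΘ1 : ∫ x, Θ x = 1) (hτ : 0 ≤ τ) {x : Rn n}
    (hx : ∀ t : ℝ, |t| ≤ τ → ∀ z ∈ tsupport Θ, x + t • v - z ∈ B) :
    ∫ z, Θ z * (U (x + τ • v - z) + U (x - τ • v - z) - 2 * U (x - z)) ≤
      A ^ (1 / p) * (eLpNorm f (ENNReal.ofReal p) (volume.restrict B)).toReal * τ ^ 2 := by
  have : IsFiniteMeasure (volume.restrict B) := ⟨by simpa using hBf.lt_top⟩
  set L := ContinuousLinearMap.mul ℝ ℝ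
  have hdir : ∀ θ : Rn n → ℝ, ContDiff ℝ ∞ θ → HasCompactSupport θ →
      ContDiff ℝ ∞ (fun z => fderiv ℝ θ z v) ∧ HasCompactSupport (fun z => fderiv ℝ θ z v) :=
    fun θ hθ hθc => ⟨(hθ.fderiv_right (by simp)).clm_apply contDiff_const, hθc.fderiv_apply ℝ v⟩
  have hder : ∀ θ : Rn n → ℝ, ContDiff ℝ ∞ θ → HasCompactSupport θ → ∀ t : ℝ,
      HasDerivAt (fun t : ℝ => convolution U θ L volume (x + t • v))
        (convolution U (fun z => fderiv ℝ θ z v) L volume (x + t • v)) t := by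
    intro θ hθ hθc t
    have h1 := hθc.hasFDerivAt_convolution_right L (μ := volume) hU.locallyIntegrable
      (hθ.of_le (by exact_mod_cast le_top)) (x + t • v)
    have h2 : HasDerivAt (fun t : ℝ => x + t • v) v t := by
      simpa using ((hasDerivAt_id t).smul_const v).const_add x
    have h3 := h1.comp_hasDerivAt t h2
    rwa [convolution_precompR_apply L hU.locallyIntegrable (hθc.fderiv ℝ)
      (hθ.continuous_fderiv (by simp))] at h3
  obtain ⟨hs1, hc1⟩ := hdir Θ hΘ hΘc
  have hsecond : ∀ t : ℝ, |t| ≤ τ →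
      convolution U (fun z => fderiv ℝ (fun z => fderiv ℝ Θ z v) z v) L volume (x + t • v) ≤
        A ^ (1 / p) * (eLpNorm f (ENNReal.ofReal p) (volume.restrict B)).toReal := by
    intro t ht
    set y := x + t • v
    have hφ : ContDiff ℝ ∞ fun z => Θ (y - z) := hΘ.comp (contDiff_const.sub contDiff_id)
    have hφs : tsupport (fun z => Θ (y - z)) ⊆ {z | y - z ∈ tsupport Θ} :=
      closure_minimal (fun z hz => subset_tsupport _ hz)
        ((isClosed_tsupport Θ).preimage (by fun_prop))
    have hφB : tsupport (fun z => Θ (y - z)) ⊆ B := fun z hz => by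
      have := hx t ht _ (hφs hz)
      rwa [sub_sub_cancel] at this
    have hφc : HasCompactSupport fun z => Θ (y - z) := by
      refine HasCompactSupport.of_support_subset_isCompact (K := (fun z => y - z) '' tsupport Θ)
        (hΘc.isCompact.image (by fun_prop)) fun z hz => ⟨y - z, subset_tsupport _ hz, by simp⟩
    have hD : ∀ θ : Rn n → ℝ, ContDiff ℝ ∞ θ → ∀ z,
        fderiv ℝ (fun z => θ (y - z)) z v = -(fderiv ℝ θ (y - z) v) := by
      intro θ hθ z
      have h := ((hθ.differentiable (by simp)) (y - z)).hasFDerivAt.comp z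
        ((hasFDerivAt_id z).const_sub y)
      have h' : fderiv ℝ (fun z => θ (y - z)) z = _ := h.fderiv
      rw [h']
      simp
    have hDD : ∀ z, fderiv ℝ (fun z => fderiv ℝ (fun z => Θ (y - z)) z v) z v =
        fderiv ℝ (fun z => fderiv ℝ Θ z v) (y - z) v := by
      intro z
      rw [show (fun z => fderiv ℝ (fun z => Θ (y - z)) z v) = fun z => -(fderiv ℝ Θ (y - z) v) from
        funext (hD Θ hΘ), fderiv_fun_neg, neg_apply, hD _ hs1, neg_neg]
    have h1 := hweak _ hφ hφc hφB
    simp only [hDD] at h1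
    have h2 : convolution U (fun z => fderiv ℝ (fun z => fderiv ℝ Θ z v) z v) L volume y =
        ∫ z in B, f z * Θ (y - z) := h1
    rw [h2]
    have hint : Integrable fun z => Θ (y - z) := hφ.continuous.integrable_of_hasCompactSupport hφc
    refine integral_mul_le_of_density hp hf hint.restrict (fun z => hΘ0 _) (fun z => hΘA _) ?_
    refine (setIntegral_le_integral hint (Filter.Eventually.of_forall fun z => hΘ0 _)).trans_eq ?_
    rw [integral_sub_left_eq_self Θ volume y, hΘ1]
  have key := second_difference_le_of_hasDerivAt hτ (hder Θ hΘ hΘc) (hder _ hs1 hc1) hsecond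
  have hconv : ∀ y, convolution U Θ L volume y = ∫ z, Θ z * U (y - z) := by
    intro y
    rw [convolution_def, ← integral_sub_left_eq_self _ volume y]
    simp [L, mul_comm]
  have hint : ∀ y, Integrable fun z => Θ z * U (y - z) := fun y =>
    (hΘ.continuous.mul (hU.comp (by fun_prop))).integrable_of_hasCompactSupport hΘc.mul_right
  refine le_of_eq_of_le ?_ key
  rw [hconv, hconv, hconv, zero_smul, add_zero, neg_smul, ← sub_eq_add_neg, ← integral_const_mul,
    ← integral_add (hint _) (hint _)]
  rw [← integral_sub (by exact (hint _).add (hint _)) ((hint _).const_mul 2)]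
  refine integral_congr_ae (Filter.Eventually.of_forall fun z => ?_)
  ring

/-- A convex function that is small at the origin and whose averaged second differences in the
coordinate directions are small is small near the origin. -/
theorem ConvexOn.le_of_averaged_second_difference_le {n : ℕ} (hn : 1 ≤ n) {W ψ : Rn n → ℝ}
    {δ h T : ℝ} (hδ : 0 < δ) (hW : Continuous W)
    (hconv : ConvexOn ℝ (Metric.closedBall 0 (2 * δ)) W)
    (hW0 : ∀ y ∈ Metric.closedBall (0 : Rn n) (2 * δ), 0 ≤ W y) (hWh : W 0 ≤ h)
    (hψ : Continuous ψ) (hψ0 : ∀ z, 0 ≤ ψ z) (hψ1 : ∫ z, ψ z = 1) (hψe : ∀ z, ψ (-z) = ψ z)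
    (hψs : ∀ z, ψ z ≠ 0 → ‖z‖ ≤ δ / (4 * n))
    (hT : ∀ i : Fin n, ∫ z, ψ z * (W (δ • stdVec i - z) + W (-(δ • stdVec i) - z) - 2 * W (-z))
      ≤ T)
    {y : Rn n} (hy : ‖y‖ ≤ δ / n) : W y ≤ 5 * h + 2 * T := by
  have hn0 : (0 : ℝ) < n := by exact_mod_cast hn
  have hn1 : (1 : ℝ) ≤ n := by exact_mod_cast hn
  have : Nonempty (Fin n) := ⟨⟨0, hn⟩⟩
  have hnorm : ∀ (i : Fin n) (a : ℝ), ‖a • (stdVec i : Rn n)‖ = |a| := fun i a => by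
    simp [stdVec, norm_smul]
  -- The sign `0` is admitted, adding the origin to the vertices `± δ eᵢ`, because `SignType.sign (y
  -- i)` may vanish below.
  obtain ⟨⟨i₀, ε₀⟩, hmax⟩ := Finite.exists_max
    (fun q : Fin n × SignType => W (((q.2 : ℝ) * δ) • stdVec q.1))
  set S := W (((ε₀ : ℝ) * δ) • stdVec i₀) with hS
  have hmem : ∀ (ε : SignType) (i : Fin n),
      ((ε : ℝ) * δ) • stdVec i ∈ Metric.closedBall (0 : Rn n) (2 * δ) := fun ε i => by
    rw [mem_closedBall_zero_iff, hnorm, abs_mul, abs_of_pos hδ]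
    have : |(ε : ℝ)| ≤ 1 := by cases ε <;> simp
    nlinarith
  have hS0 : 0 ≤ S := hW0 _ (hmem _ _)
  -- In the cross-polytope, `y` is a convex combination of vertices with weights `|y i| / δ` and of
  -- the origin with the remaining weight.
  have hpoly : ∀ y : Rn n, ∑ i, |y i| ≤ δ → W y ≤ (∑ i, |y i|) / δ * S + h := by
    intro y hy
    have hy' : (∑ i, |y i|) / δ ≤ 1 := (div_le_one hδ).2 hy
    have key := hconv.map_sum_le (t := Finset.univ)
      (w := fun o : Option (Fin n) => o.elim (1 - (∑ i, |y i|) / δ) fun i => |y i| / δ)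
      (p := fun o => o.elim 0 fun i => ((SignType.sign (y i) : ℝ) * δ) • stdVec i)
      (by
        rintro (_ | i) -
        · simpa using hy'
        · exact div_nonneg (abs_nonneg _) hδ.le)
      (by simp [Fintype.sum_option, Finset.sum_div])
      (by
        rintro (_ | i) -
        · simp [hδ.le]
        · exact hmem _ _)
    have hpt : ∑ i : Fin n, (|y i| / δ) • (((SignType.sign (y i) : ℝ) * δ) • (stdVec i : Rn n)) = y := by
      have h1 : ∀ i : Fin n, (|y i| / δ) • (((SignType.sign (y i) : ℝ) * δ) • (stdVec i : Rn n)) =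
          y i • stdVec i := fun i => by
        rw [smul_smul]
        congr 1
        rw [mul_comm (SignType.sign (y i) : ℝ), ← mul_assoc, div_mul_cancel₀ _ hδ.ne',
          abs_mul_sign]
      rw [Finset.sum_congr rfl fun i _ => h1 i]
      ext j
      simp [stdVec, Finset.sum_apply, Pi.single_apply]
    simp only [Fintype.sum_option, Option.elim, smul_zero, zero_add, hpt, smul_eq_mul] at key
    refine key.trans ?_
    rw [add_comm, Finset.sum_div, Finset.sum_mul]
    refine add_le_add (Finset.sum_le_sum fun i _ =>
      mul_le_mul_of_nonneg_left (hmax (i, SignType.sign (y i))) (by positivity)) ?_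
    refine (mul_le_of_le_one_left (hW0 0 (by simp [hδ.le])) ?_).trans hWh
    have : 0 ≤ ∑ i, |y i| / δ := by positivity
    linarith
  have hsum : ∀ y : Rn n, ∑ i, |y i| ≤ n * ‖y‖ := fun y => by
    refine (Finset.sum_le_card_nsmul _ _ ‖y‖ fun i _ => ?_).trans_eq (by simp)
    exact PiLp.norm_apply_le y i
  have hψc : HasCompactSupport ψ :=
    HasCompactSupport.of_support_subset_isCompact (isCompact_closedBall 0 (δ / (4 * n)))
      fun z hz => by simpa using hψs z hz
  have hint : ∀ v : Rn n, Integrable fun z => ψ z * W (v - z) := fun v =>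
    (hψ.mul (hW.comp (by fun_prop))).integrable_of_hasCompactSupport hψc.mul_right
  have hψi : Integrable ψ := hψ.integrable_of_hasCompactSupport hψc
  have hδn : δ / (4 * n) ≤ δ := div_le_self hδ.le (by linarith)
  -- Averaging against an even density can only increase a convex function.
  have hcentre : ∀ v : Rn n, ‖v‖ ≤ δ → W v ≤ ∫ z, ψ z * W (v - z) := by
    intro v hv
    have hrefl : ∫ z, ψ z * W (v + z) = ∫ z, ψ z * W (v - z) := by
      rw [← integral_neg_eq_self]
      simp only [hψe, ← sub_eq_add_neg]
    have hint' : Integrable fun z => ψ z * W (v + z) :=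
      (hψ.mul (hW.comp (by fun_prop))).integrable_of_hasCompactSupport hψc.mul_right
    have h2 : ∫ z, ψ z * (2 * W v) ≤ ∫ z, (ψ z * W (v - z) + ψ z * W (v + z)) := by
      refine integral_mono (hψi.mul_const _) ((hint v).add hint') fun z => ?_
      simp only [← mul_add]
      by_cases hz : ψ z = 0
      · simp [hz]
      refine mul_le_mul_of_nonneg_left ?_ (hψ0 z)
      have hzn := hψs z hz
      have h3 := hconv.2 (x := v - z) (y := v + z)
        (by rw [mem_closedBall_zero_iff]; linarith [norm_sub_le v z])
        (by rw [mem_closedBall_zero_iff]; linarith [norm_add_le v z])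
        (show (0 : ℝ) ≤ 1 / 2 by norm_num) (show (0 : ℝ) ≤ 1 / 2 by norm_num) (by norm_num)
      rw [show (1 / 2 : ℝ) • (v - z) + (1 / 2 : ℝ) • (v + z) = v by module] at h3
      simp only [smul_eq_mul] at h3
      linarith
    rw [integral_mul_const, hψ1, integral_add (hint v) hint', hrefl] at h2
    linarith
  -- The support radius `δ / (4 n)` keeps `z` in a quarter of the cross-polytope. The factor `1 / 4`
  -- lets `S ≤ S / 2 + 2 h + T` be absorbed below.
  have hcore : ∫ z, ψ z * W (-z) ≤ S / 4 + h := by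
    have h1 : ∫ z, ψ z * W (-z) ≤ ∫ z, ψ z * (S / 4 + h) := by
      refine integral_mono (by simpa using hint 0) (hψi.mul_const _) fun z => ?_
      by_cases hz : ψ z = 0
      · simp [hz]
      refine mul_le_mul_of_nonneg_left ?_ (hψ0 z)
      have h2 : ∑ i, |(-z) i| ≤ δ / 4 := by
        refine (hsum (-z)).trans ?_
        rw [norm_neg]
        calc (n : ℝ) * ‖z‖ ≤ n * (δ / (4 * n)) := by gcongr; exact hψs z hz
          _ = δ / 4 := by field_simp
      refine (hpoly (-z) (by linarith)).trans ?_
      have h3 : (∑ i, |(-z) i|) / δ ≤ 1 / 4 := by rw [div_le_iff₀ hδ]; linarith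
      have := mul_le_mul_of_nonneg_right h3 hS0
      linarith
    rwa [integral_mul_const, hψ1, one_mul] at h1
  have hpair : ∀ i : Fin n, W (δ • stdVec i) + W (-(δ • stdVec i)) ≤ S / 2 + 2 * h + T := by
    intro i
    have h1 := hT i
    have h2 : ∫ z, ψ z * (W (δ • stdVec i - z) + W (-(δ • stdVec i) - z) - 2 * W (-z)) =
        (∫ z, ψ z * W (δ • stdVec i - z)) + (∫ z, ψ z * W (-(δ • stdVec i) - z)) -
          2 * ∫ z, ψ z * W (-z) := by
      have h0 : Integrable fun z => ψ z * W (-z) := by simpa using hint 0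
      rw [← integral_add (hint _) (hint _), ← integral_const_mul,
        ← integral_sub (by exact (hint _).add (hint _)) (h0.const_mul 2)]
      refine integral_congr_ae (Filter.Eventually.of_forall fun z => ?_)
      ring
    have h3 := hcentre (δ • stdVec i) (by rw [hnorm, abs_of_pos hδ])
    have h4 := hcentre (-(δ • stdVec i)) (by rw [norm_neg, hnorm, abs_of_pos hδ])
    linarith
  have hT0 : 0 ≤ W (δ • stdVec i₀) ∧ 0 ≤ W (-(δ • stdVec i₀)) :=
    ⟨by simpa using hW0 _ (hmem 1 i₀), by simpa using hW0 _ (hmem (-1) i₀)⟩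
  have hSle : S ≤ 4 * h + 2 * T := by
    have h1 := hpair i₀
    have h2 : S ≤ S / 2 + 2 * h + T := by
      cases ε₀
      · simp only [SignType.zero_eq_zero, SignType.coe_zero, zero_mul, zero_smul] at hS
        have h3 := hconv.2 (x := δ • stdVec i₀) (y := -(δ • stdVec i₀))
          (by simpa using hmem 1 i₀) (by simpa using hmem (-1) i₀)
          (show (0 : ℝ) ≤ 1 / 2 by norm_num) (show (0 : ℝ) ≤ 1 / 2 by norm_num) (by norm_num)
        rw [show (1 / 2 : ℝ) • (δ • stdVec i₀ : Rn n) + (1 / 2 : ℝ) • (-(δ • stdVec i₀)) = 0 by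
          module, smul_eq_mul, smul_eq_mul] at h3
        linarith
      · simp only [SignType.neg_eq_neg_one, SignType.coe_neg_one, neg_mul, one_mul,
          neg_smul] at hS
        linarith
      · simp only [SignType.pos_eq_one, SignType.coe_one, one_mul] at hS
        linarith
    linarith
  have h1 : ∑ i, |y i| ≤ δ := by
    refine (hsum y).trans ?_
    calc (n : ℝ) * ‖y‖ ≤ n * (δ / n) := by gcongr
      _ = δ := by field_simp
  have h2 := hpoly y h1
  have h3 : (∑ i, |y i|) / δ * S ≤ S := mul_le_of_le_one_left hS0 ((div_le_one hδ).2 h1)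
  linarith

/-! ### Averaging along a line. -/

theorem Finset.sum_Icc_neg_intCast (m : ℕ) : ∑ j ∈ Finset.Icc (-m : ℤ) m, (j : ℝ) = 0 := by
  have h : ∑ j ∈ Finset.Icc (-m : ℤ) m, (j : ℝ) = ∑ j ∈ Finset.Icc (-m : ℤ) m, ((-j : ℤ) : ℝ) :=
    Finset.sum_nbij' (fun j => -j) (fun j => -j) (by intro j; simp; omega) (by intro j; simp; omega)
      (by simp) (by simp) (by simp)
  simp only [Int.cast_neg, Finset.sum_neg_distrib] at h
  linarith

theorem Int.card_Icc_neg_self (m : ℕ) : ((Finset.Icc (-m : ℤ) m).card : ℝ) = 2 * m + 1 := by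
  rw [Int.card_Icc, show (m : ℤ) + 1 - -m = ((2 * m + 1 : ℕ) : ℤ) by push_cast; ring, Int.toNat_natCast]
  push_cast; ring

/-- The arithmetic mean of `F` over the integers of absolute value at most `m`. -/
noncomputable def symmMean (m : ℕ) (F : ℤ → ℝ) : ℝ :=
  (2 * m + 1 : ℝ)⁻¹ * ∑ j ∈ Finset.Icc (-m : ℤ) m, F j

theorem symmMean_const (m : ℕ) (a : ℝ) : symmMean m (fun _ => a) = a := by
  have : (2 * m + 1 : ℝ) ≠ 0 := by positivity
  rw [symmMean, Finset.sum_const, nsmul_eq_mul, Int.card_Icc_neg_self, inv_mul_cancel_left₀ this]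

theorem symmMean_mono {m : ℕ} {F F' : ℤ → ℝ} (h : ∀ j ∈ Finset.Icc (-m : ℤ) m, F j ≤ F' j) :
    symmMean m F ≤ symmMean m F' :=
  mul_le_mul_of_nonneg_left (Finset.sum_le_sum h) (by positivity)

theorem ConvexOn.le_symmMean {E : Type*} [AddCommGroup E] [Module ℝ E] {s : Set E} {w : E → ℝ}
    (hw : ConvexOn ℝ s w) {m : ℕ} {x d : E}
    (h : ∀ j ∈ Finset.Icc (-m : ℤ) m, x + (j : ℝ) • d ∈ s) :
    w x ≤ symmMean m fun j => w (x + (j : ℝ) • d) := by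
  have hN : (0 : ℝ) < 2 * m + 1 := by positivity
  have key := hw.map_sum_le (t := Finset.Icc (-m : ℤ) m) (w := fun _ => (2 * m + 1 : ℝ)⁻¹)
    (p := fun j => x + (j : ℝ) • d) (fun _ _ => by positivity)
    (by rw [Finset.sum_const, nsmul_eq_mul, Int.card_Icc_neg_self, mul_inv_cancel₀ hN.ne']) h
  have hx : ∑ j ∈ Finset.Icc (-m : ℤ) m, (2 * m + 1 : ℝ)⁻¹ • (x + (j : ℝ) • d) = x := by
    rw [← Finset.smul_sum, Finset.sum_add_distrib, ← Finset.sum_smul, Finset.sum_Icc_neg_intCast,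
      zero_smul, add_zero, Finset.sum_const, ← Nat.cast_smul_eq_nsmul ℝ, Int.card_Icc_neg_self,
      inv_smul_smul₀ hN.ne']
  rw [hx] at key
  simpa only [symmMean, Finset.mul_sum, smul_eq_mul] using key

section spreadKernel

variable {n : ℕ} {ψ : Rn n → ℝ} {e : Rn n} {m : ℕ} {η : ℝ}

/-- The mean of the translates of `ψ` by the multiples `j η e` with `|j| ≤ m`. -/
noncomputable def spreadKernel (ψ : Rn n → ℝ) (e : Rn n) (m : ℕ) (η : ℝ) (z : Rn n) : ℝ :=
  symmMean m fun j => ψ (z + (j : ℝ) • η • e)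

theorem contDiff_spreadKernel (hψ : ContDiff ℝ ∞ ψ) : ContDiff ℝ ∞ (spreadKernel ψ e m η) :=
  contDiff_const.mul (ContDiff.sum fun _ _ => hψ.comp (contDiff_id.add contDiff_const))

theorem spreadKernel_nonneg (hψ : ∀ z, 0 ≤ ψ z) (z : Rn n) : 0 ≤ spreadKernel ψ e m η z :=
  mul_nonneg (by positivity) (Finset.sum_nonneg fun _ _ => hψ _)

/-- Translation moves the averaging from the kernel to the function: testing `D` with the spread
kernel is testing its average along the line with `ψ`. -/
theorem integral_spreadKernel_mul {D : Rn n → ℝ} (hψ : Continuous ψ) (hψc : HasCompactSupport ψ)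
    (hD : Continuous D) :
    ∫ z, spreadKernel ψ e m η z * D z =
      ∫ z, ψ z * symmMean m fun j => D (z - (j : ℝ) • η • e) := by
  have h1 : ∀ j : ℤ, Integrable fun z => ψ (z + (j : ℝ) • η • e) * D z := fun j =>
    ((hψ.comp (by fun_prop)).mul hD).integrable_of_hasCompactSupport
      ((hψc.comp_homeomorph (Homeomorph.addRight ((j : ℝ) • η • e))).mul_right)
  have h2 : ∀ j : ℤ, Integrable fun z => ψ z * D (z - (j : ℝ) • η • e) := fun j =>
    (hψ.mul (hD.comp (by fun_prop))).integrable_of_hasCompactSupport hψc.mul_right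
  simp only [spreadKernel, symmMean, mul_assoc, Finset.sum_mul, mul_left_comm (ψ _)]
  rw [integral_const_mul, integral_const_mul, integral_finsetSum _ fun j _ => h1 j]
  congr 1
  simp only [Finset.mul_sum]
  rw [integral_finsetSum _ fun j _ => h2 j]
  refine Finset.sum_congr rfl fun j _ => ?_
  rw [← integral_sub_right_eq_self (fun z => ψ (z + (j : ℝ) • η • e) * D z) ((j : ℝ) • η • e)]
  simp

theorem integral_spreadKernel (hψ : Continuous ψ) (hψc : HasCompactSupport ψ)
    (hψ1 : ∫ z, ψ z = 1) : ∫ z, spreadKernel ψ e m η z = 1 := by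
  have := integral_spreadKernel_mul (e := e) (m := m) (η := η) hψ hψc
    (continuous_const (y := (1 : ℝ)))
  simpa [symmMean_const, hψ1] using this

theorem tsupport_spreadKernel_subset {r : ℝ} (hψ : ∀ z, ψ z ≠ 0 → ‖z‖ ≤ r) :
    tsupport (spreadKernel ψ e m η) ⊆
      ⋃ j ∈ Finset.Icc (-m : ℤ) m, Metric.closedBall (-((j : ℝ) • η • e)) r := by
  refine closure_minimal (fun z hz => ?_)
    (Set.Finite.isClosed_biUnion (Finset.finite_toSet _) fun j _ => Metric.isClosed_closedBall)
  obtain ⟨j, hj, hne⟩ := Finset.exists_ne_zero_of_sum_ne_zero (right_ne_zero_of_mul hz)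
  simp only [Set.mem_iUnion]
  refine ⟨j, hj, ?_⟩
  rw [Metric.mem_closedBall, dist_eq_norm, sub_neg_eq_add]
  exact hψ _ hne

theorem hasCompactSupport_spreadKernel {r : ℝ} (hψ : ∀ z, ψ z ≠ 0 → ‖z‖ ≤ r) :
    HasCompactSupport (spreadKernel ψ e m η) :=
  (Finset.isCompact_biUnion _ fun _ _ => isCompact_closedBall _ _).of_isClosed_subset
    (isClosed_tsupport _) (tsupport_spreadKernel_subset hψ)

/-- The translates have disjoint supports, since the radius is below half the spacing `η`. At most
one summand is nonzero, and the mean gains the factor `1 / (2 m + 1)`. -/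
theorem spreadKernel_le {A : ℝ} (he : ‖e‖ = 1) (hA : 0 ≤ A) (hη : 0 < η)
    (hψs : ∀ z, ψ z ≠ 0 → ‖z‖ < η / 2) (hψA : ∀ z, ψ z ≤ A) (z : Rn n) :
    spreadKernel ψ e m η z ≤ A / (2 * m + 1) := by
  rw [spreadKernel, symmMean, div_eq_inv_mul]
  refine mul_le_mul_of_nonneg_left ?_ (by positivity)
  by_cases hz : ∃ j ∈ Finset.Icc (-m : ℤ) m, ψ (z + (j : ℝ) • η • e) ≠ 0
  · obtain ⟨j, hj, hne⟩ := hz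
    rw [Finset.sum_eq_single j (fun i _ hij => ?_) (fun h => absurd hj h)]
    · exact hψA _
    by_contra hi
    have h1 := norm_sub_le (z + (i : ℝ) • η • e) (z + (j : ℝ) • η • e)
    rw [show z + (i : ℝ) • η • e - (z + (j : ℝ) • η • e) = (((i - j : ℤ) : ℝ) * η) • e by
      push_cast; module, norm_smul, he, mul_one, Real.norm_eq_abs, abs_mul, abs_of_pos hη] at h1
    have h2 : (1 : ℝ) ≤ |((i - j : ℤ) : ℝ)| := by
      exact_mod_cast Int.one_le_abs (sub_ne_zero.2 hij)
    have h3 := hψs _ hi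
    have h4 := hψs _ hne
    nlinarith
  · push Not at hz
    rw [Finset.sum_eq_zero hz]
    exact hA

end spreadKernel

/-- A convex function `U` with second derivatives in `L^p` that is close to a supporting affine
function on `2 m + 1` equally spaced points of a line is close to it near their centre. -/
theorem ConvexOn.sub_affine_le_of_weak_hessian {n : ℕ} (hn : 1 ≤ n) {B : Set (Rn n)}
    (hBf : volume B ≠ ⊤) {U : Rn n → ℝ} (hU : Continuous U) (hconv : ConvexOn ℝ B U)
    {f : Fin n → Rn n → ℝ} {p F : ℝ} (hp : 1 < p)
    (hf : ∀ i, MemLp (f i) (ENNReal.ofReal p) (volume.restrict B))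
    (hF : ∀ i, (eLpNorm (f i) (ENNReal.ofReal p) (volume.restrict B)).toReal ≤ F)
    (hweak : ∀ i, ∀ φ : Rn n → ℝ, ContDiff ℝ ∞ φ → HasCompactSupport φ → tsupport φ ⊆ B →
      ∫ x, U x * fderiv ℝ (fun z => fderiv ℝ φ z (stdVec i)) x (stdVec i) = ∫ x in B, f i x * φ x)
    {a : ℝ} {L : Rn n →L[ℝ] ℝ} {c e : Rn n} (he : ‖e‖ = 1) {m : ℕ} {δ h : ℝ} (hδ : 0 < δ)
    (hin : ∀ j ∈ Finset.Icc (-m : ℤ) m, ∀ y : Rn n, ‖y‖ ≤ 2 * δ →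
      c + (j : ℝ) • (δ / (2 * n)) • e + y ∈ B)
    (hpos : ∀ x ∈ B, a + L x ≤ U x)
    (hh : ∀ j ∈ Finset.Icc (-m : ℤ) m, U (c + (j : ℝ) • (δ / (2 * n)) • e) -
      (a + L (c + (j : ℝ) • (δ / (2 * n)) • e)) ≤ h)
    {y : Rn n} (hy : ‖y‖ ≤ δ / n) :
    U (c + y) - (a + L (c + y)) ≤ 5 * h +
      2 * (((8 * n : ℝ) ^ n / volume.real (Metric.ball (0 : Rn n) 1) / (δ ^ n * (2 * m + 1))) ^
        (1 / p) * F * δ ^ 2) := by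
  have hn0 : (0 : ℝ) < n := by exact_mod_cast hn
  have hn1 : (1 : ℝ) ≤ n := by exact_mod_cast hn
  set η := δ / (2 * n) with hη
  have hη0 : 0 < η := by positivity
  -- The outer radius is `η / 2`, as disjointness of the translates requires, and it is twice the
  -- inner radius, whence the constant `(8 n) ^ n`.
  let χ : ContDiffBump (0 : Rn n) := ⟨δ / (8 * n), δ / (4 * n), by positivity, by
    gcongr; norm_num⟩
  set ψ : Rn n → ℝ := χ.normed volume with hψ_def
  have hψ : ContDiff ℝ ∞ ψ := χ.contDiff_normed
  have hψc : HasCompactSupport ψ := χ.hasCompactSupport_normed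
  have hψs : ∀ z, ψ z ≠ 0 → ‖z‖ < δ / (4 * n) := fun z hz => by
    have : z ∈ Function.support ψ := hz
    rw [hψ_def, χ.support_normed_eq] at this
    simpa using this
  have hκ : 0 < volume.real (Metric.ball (0 : Rn n) 1) :=
    ENNReal.toReal_pos (Metric.measure_ball_pos volume _ one_pos).ne' measure_ball_lt_top.ne
  have hψA : ∀ z, ψ z ≤ (8 * n : ℝ) ^ n / volume.real (Metric.ball (0 : Rn n) 1) / δ ^ n := by
    intro z
    refine (χ.normed_le_div_measure_closedBall_rOut volume 2 (le_of_eq ?_) z).trans_eq ?_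
    · simp only [χ]; field_simp; norm_num
    · rw [Measure.addHaar_real_closedBall _ _ χ.rOut_pos.le, finrank_euclideanSpace_fin]
      simp only [χ]
      rw [div_pow, show (8 * n : ℝ) = 2 * (4 * n) by ring, mul_pow (2 : ℝ) (4 * n)]
      field_simp
  have hΘA : ∀ z, spreadKernel ψ e m η z ≤
      (8 * n : ℝ) ^ n / volume.real (Metric.ball (0 : Rn n) 1) / (δ ^ n * (2 * m + 1)) := by
    intro z
    rw [← div_div _ (δ ^ n)]
    refine spreadKernel_le he (by positivity) hη0 (fun z hz => (hψs z hz).trans_eq ?_) hψA z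
    rw [hη]; field_simp; norm_num
  set w : Rn n → ℝ := fun x => U x - (a + L x) with hw
  have hwc : Continuous w := hU.sub (continuous_const.add L.continuous)
  have hwconv : ConvexOn ℝ B w := by
    refine ⟨hconv.1, fun x hx y hy p q hp hq hpq => ?_⟩
    have := hconv.2 hx hy hp hq hpq
    simp only [hw, map_add, map_smul, smul_eq_mul] at this ⊢
    have : a = p * a + q * a := by rw [← add_mul, hpq, one_mul]
    linarith
  -- By Jensen `w (c + y) ≤ W y`, and `W` is again convex and nonnegative with `W 0 ≤ h`. Its second
  -- differences tested with `ψ` are those of `U` tested with the spread kernel, as affine terms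
  -- drop out.
  set W : Rn n → ℝ := fun y => symmMean m fun j => w (c + (j : ℝ) • η • e + y) with hW
  have hmem : ∀ j ∈ Finset.Icc (-m : ℤ) m, ∀ y ∈ Metric.closedBall (0 : Rn n) (2 * δ),
      c + (j : ℝ) • η • e + y ∈ B := fun j hj y hy => hin j hj y (by simpa using hy)
  have hδn : δ / n ≤ δ := div_le_self hδ.le hn1
  have hwW : w (c + y) ≤ W y := by
    have := hwconv.le_symmMean (m := m) (x := c + y) (d := η • e) fun j hj => by
      rw [add_right_comm]
      exact hin j hj y (by linarith)
    simpa only [hW, add_right_comm] using this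
  refine hwW.trans (ConvexOn.le_of_averaged_second_difference_le hn (W := W) (ψ := ψ) hδ ?_ ?_ ?_ ?_
    hψ.continuous χ.nonneg_normed χ.integral_normed χ.normed_neg (fun z hz => (hψs z hz).le) ?_ hy)
  · exact continuous_const.mul (continuous_finsetSum _ fun j _ => hwc.comp (by fun_prop))
  · refine ⟨convex_closedBall _ _, fun x hx y hy p q hp hq hpq => ?_⟩
    simp only [hW, symmMean, smul_eq_mul]
    rw [mul_left_comm p, mul_left_comm q, ← mul_add, Finset.mul_sum _ _ p, Finset.mul_sum _ _ q,
      ← Finset.sum_add_distrib]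
    refine mul_le_mul_of_nonneg_left (Finset.sum_le_sum fun j hj => ?_) (by positivity)
    refine le_of_eq_of_le ?_ (hwconv.2 (hmem j hj x hx) (hmem j hj y hy) hp hq hpq)
    congr 1
    obtain rfl : q = 1 - p := by linarith
    module
  · intro y hy
    rw [hW, ← symmMean_const m 0]
    exact symmMean_mono fun j hj => by linarith [hpos _ (hmem j hj y hy)]
  · rw [hW, ← symmMean_const m h]
    exact symmMean_mono fun j hj => by simpa [hw] using hh j hj
  · intro i
    have hv : ‖δ • (stdVec i : Rn n)‖ = δ := by simp [stdVec, norm_smul, abs_of_pos hδ]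
    have key := integral_second_difference_le hBf hU hp (hf i) (hweak i) (τ := δ) (x := c)
      (contDiff_spreadKernel (e := e) (m := m) (η := η) hψ)
      (hasCompactSupport_spreadKernel fun z hz => (hψs z hz).le)
      (spreadKernel_nonneg χ.nonneg_normed) hΘA
      (integral_spreadKernel hψ.continuous hψc χ.integral_normed) hδ.le (by
        intro t ht z hz
        have hz' := tsupport_spreadKernel_subset (fun z hz => (hψs z hz).le) hz
        simp only [Set.mem_iUnion] at hz'
        obtain ⟨j, hj, hz'⟩ := hz'
        rw [Metric.mem_closedBall, dist_eq_norm, sub_neg_eq_add] at hz'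
        rw [show c + t • stdVec i - z = c + (j : ℝ) • η • e +
          (t • stdVec i - (z + (j : ℝ) • η • e)) by abel]
        refine hin j hj _ ((norm_sub_le _ _).trans ?_)
        have h1 : ‖t • (stdVec i : Rn n)‖ = |t| := by simp [stdVec, norm_smul]
        have h2 : δ / (4 * n) ≤ δ := div_le_self hδ.le (by linarith)
        linarith)
    rw [integral_spreadKernel_mul hψ.continuous hψc (by fun_prop)] at key
    refine le_of_eq_of_le ?_ (key.trans ?_)
    · refine integral_congr_ae (Filter.Eventually.of_forall fun z => ?_)
      simp only [hW, symmMean]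
      congr 1
      rw [← mul_add, ← Finset.sum_add_distrib, mul_left_comm 2, ← mul_sub, Finset.mul_sum,
        ← Finset.sum_sub_distrib]
      congr 1
      refine Finset.sum_congr rfl fun j _ => ?_
      simp only [hw]
      rw [show c + (j : ℝ) • η • e + (δ • stdVec i - z) =
          c + δ • stdVec i - (z - (j : ℝ) • η • e) by abel,
        show c + (j : ℝ) • η • e + (-(δ • stdVec i) - z) =
          c - δ • stdVec i - (z - (j : ℝ) • η • e) by abel,
        show c + (j : ℝ) • η • e + -z = c - (z - (j : ℝ) • η • e) by abel]
      simp only [map_add, map_sub]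
      ring
    · have := hF i
      gcongr

/-! ### Case 2: second derivatives in `L^p`. -/

theorem HasWeakDerivs.integral_second_partial {n : ℕ} {Ω B : Set (Rn n)} (hBΩ : B ⊆ Ω)
    {u U : Rn n → ℝ} (hUu : Set.EqOn U u B) {g : Fin n → Rn n → ℝ} {h : Fin n → Fin n → Rn n → ℝ}
    (hw : HasWeakDerivs Ω u g h) (i : Fin n) {φ : Rn n → ℝ} (hφ : ContDiff ℝ ∞ φ)
    (hφc : HasCompactSupport φ) (hφB : tsupport φ ⊆ B) :
    ∫ x, U x * fderiv ℝ (fun z => fderiv ℝ φ z (stdVec i)) x (stdVec i) =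
      ∫ x in B, h i i x * φ x := by
  have hsub : ∀ θ : Rn n → ℝ, tsupport (fun z => fderiv ℝ θ z (stdVec i)) ⊆ tsupport θ :=
    fun θ => tsupport_fderiv_apply_subset ℝ _
  have hφ' : ContDiff ℝ ∞ fun z => fderiv ℝ φ z (stdVec i) :=
    (hφ.fderiv_right (by simp)).clm_apply contDiff_const
  have h1 := (hw.1 i).2.2 _ hφ' (hφc.fderiv_apply ℝ _) ((hsub φ).trans (hφB.trans hBΩ))
  have h2 := (hw.2 i i).2.2 φ hφ hφc (hφB.trans hBΩ)
  rw [h2, neg_neg] at h1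
  set D := fun x => fderiv ℝ (fun z => fderiv ℝ φ z (stdVec i)) x (stdVec i)
  have hD : ∀ x, x ∉ B → D x = 0 := fun x hx =>
    image_eq_zero_of_notMem_tsupport fun h => hx (hφB (hsub φ (hsub _ h)))
  have hz : ∀ x, x ∉ B → φ x = 0 := fun x hx =>
    image_eq_zero_of_notMem_tsupport fun h => hx (hφB h)
  have h3 : (fun x => U x * D x) = fun x => u x * D x := funext fun x => by
    by_cases hx : x ∈ B
    · rw [hUu hx]
    · rw [hD x hx, mul_zero, mul_zero]
  rw [setIntegral_eq_integral_of_forall_compl_eq_zero fun x hx => by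
      rw [show fderiv ℝ (fun z => fderiv ℝ φ z (stdVec i)) x (stdVec i) = 0 from
        hD x fun h => hx (hBΩ h), mul_zero],
    setIntegral_eq_integral_of_forall_compl_eq_zero fun x hx => by
      rw [hz x fun h => hx (hBΩ h), mul_zero]] at h1
  rw [setIntegral_eq_integral_of_forall_compl_eq_zero fun x hx => by rw [hz x hx, mul_zero], ← h1]
  exact congrArg (fun F : Rn n → ℝ => ∫ x, F x) h3

/-- A bound for the `L^p` norm on a ball of radius `r` in terms of a bound `M` for the `L^q` norm. -/
noncomputable def ballNormBound (n : ℕ) (r p : ℝ) (q M : ℝ≥0∞) : ℝ :=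
  (M * volume (Metric.ball (0 : Rn n) r) ^ (1 / p - 1 / q.toReal)).toReal

theorem ballNormBound_nonneg (n : ℕ) (r p : ℝ) (q M : ℝ≥0∞) : 0 ≤ ballNormBound n r p q M :=
  ENNReal.toReal_nonneg

theorem memLp_ball_of_eLpNorm_le {n : ℕ} {Ω : Set (Rn n)} {x₀ : Rn n} {r p : ℝ} (hr : 0 < r)
    (hp : 0 < p) {q M : ℝ≥0∞} (hpq : ENNReal.ofReal p ≤ q) (hM : M ≠ ⊤)
    (hball : Metric.ball x₀ r ⊆ Ω) {f : Rn n → ℝ} (hf : AEStronglyMeasurable f (volume.restrict Ω))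
    (hfM : eLpNorm f q (volume.restrict Ω) ≤ M) :
    MemLp f (ENNReal.ofReal p) (volume.restrict (Metric.ball x₀ r)) ∧
      (eLpNorm f (ENNReal.ofReal p) (volume.restrict (Metric.ball x₀ r))).toReal ≤
        ballNormBound n r p q M := by
  have hle : volume.restrict (Metric.ball x₀ r) ≤ volume.restrict Ω :=
    Measure.restrict_mono hball le_rfl
  have hmeas := hf.mono_measure hle
  have hfin : M * volume (Metric.ball (0 : Rn n) r) ^ (1 / p - 1 / q.toReal) ≠ ⊤ :=
    ENNReal.mul_ne_top hM (ENNReal.rpow_ne_top_of_ne_zero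
      (Metric.measure_ball_pos volume _ hr).ne' measure_ball_lt_top.ne)
  have h1 : eLpNorm f (ENNReal.ofReal p) (volume.restrict (Metric.ball x₀ r)) ≤
      M * volume (Metric.ball (0 : Rn n) r) ^ (1 / p - 1 / q.toReal) := by
    -- For `q = ∞` the conventions `q.toReal = 0` and `1 / 0 = 0` give the correct power `1 / p` of
    -- the volume.
    refine (eLpNorm_le_eLpNorm_mul_rpow_measure_univ hpq hmeas).trans ?_
    rw [Measure.restrict_apply_univ, Measure.addHaar_ball_center, ENNReal.toReal_ofReal hp.le]
    gcongr
    exact (eLpNorm_mono_measure f hle).trans hfM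
  exact ⟨⟨hmeas, h1.trans_lt hfin.lt_top⟩, ENNReal.toReal_mono hfin h1⟩

theorem HasWeakDerivs.sub_affine_le {n : ℕ} (hn : 1 ≤ n) {Ω : Set (Rn n)} {u : Rn n → ℝ}
    (hc : ContinuousOn u Ω) (hu : LocallyConvexOn Ω u) {g : Fin n → Rn n → ℝ}
    {H : Fin n → Fin n → Rn n → ℝ} (hw : HasWeakDerivs Ω u g H) {x₀ : Rn n} {r p : ℝ} (hr : 0 < r)
    (hp : 1 < p) {q M : ℝ≥0∞} (hpq : ENNReal.ofReal p ≤ q) (hM : M ≠ ⊤)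
    (hball : Metric.closedBall x₀ r ⊆ Ω)
    (hHM : ∀ i, eLpNorm (H i i) q (volume.restrict Ω) ≤ M)
    {a : ℝ} {L : Rn n →L[ℝ] ℝ} {c e : Rn n} (he : ‖e‖ = 1) {m : ℕ} {δ h : ℝ} (hδ : 0 < δ)
    (hin : ∀ j ∈ Finset.Icc (-m : ℤ) m, ∀ y : Rn n, ‖y‖ ≤ 2 * δ →
      c + (j : ℝ) • (δ / (2 * n)) • e + y ∈ Metric.ball x₀ r)
    (hpos : ∀ x ∈ Metric.ball x₀ r, a + L x ≤ u x)
    (hh : ∀ j ∈ Finset.Icc (-m : ℤ) m, u (c + (j : ℝ) • (δ / (2 * n)) • e) -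
      (a + L (c + (j : ℝ) • (δ / (2 * n)) • e)) ≤ h)
    {y : Rn n} (hy : ‖y‖ ≤ δ / n) :
    u (c + y) - (a + L (c + y)) ≤ 5 * h +
      2 * (((8 * n : ℝ) ^ n / volume.real (Metric.ball (0 : Rn n) 1) / (δ ^ n * (2 * m + 1))) ^
        (1 / p) * ballNormBound n r p q M * δ ^ 2) := by
  have hball' := Metric.ball_subset_closedBall.trans hball
  -- A Tietze extension replaces `u` by a function continuous on all of `ℝⁿ`, so that convolutions
  -- make sense.
  obtain ⟨U, hU⟩ := ContinuousMap.exists_restrict_eq (Metric.isClosed_closedBall (x := x₀) (ε := r))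
    ⟨(Metric.closedBall x₀ r).domRestrict u, (hc.mono hball).domRestrict⟩
  have hUu : Set.EqOn U u (Metric.ball x₀ r) := fun x hx =>
    DFunLike.congr_fun hU (⟨x, Metric.ball_subset_closedBall hx⟩ : Metric.closedBall x₀ r)
  have hmeas : ∀ i, AEStronglyMeasurable (H i i) (volume.restrict Ω) := fun i =>
    (hw.2 i i).2.1.aestronglyMeasurable
  have hLp := fun i => memLp_ball_of_eLpNorm_le hr (by linarith) hpq hM hball' (hmeas i) (hHM i)
  have hconv : ConvexOn ℝ (Metric.ball x₀ r) U :=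
    (hu.convexOn hc (convex_ball x₀ r) hball').congr hUu.symm
  have hn1 : (1 : ℝ) ≤ n := by exact_mod_cast hn
  have hc0 : c + y ∈ Metric.ball x₀ r := by
    have := hin 0 (by simp) y (hy.trans ((div_le_self hδ.le hn1).trans (by linarith)))
    simpa using this
  rw [← hUu hc0]
  refine hconv.sub_affine_le_of_weak_hessian hn measure_ball_lt_top.ne U.continuous hp
    (fun i => (hLp i).1) (fun i => (hLp i).2)
    (fun i φ hφ hφc hφB => hw.integral_second_partial hball' hUu i hφ hφc hφB) he hδ hin
    (fun x hx => by rw [hUu hx]; exact hpos x hx) (fun j hj => ?_) hy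
  rw [hUu (by simpa using hin j hj 0 (by simpa using hδ.le))]
  exact hh j hj

/-- A single ball (`m = 0`) of size `n ‖y‖` around `x₀`, with a supporting plane that is exact there
(`h = 0`), bounds the remainder by a multiple of `‖y‖ ^ (2 - n / p)`. The exponent exceeds `1`
because `p > n`. -/
theorem HasWeakDerivs.differentiableAt {n : ℕ} (hn : 1 ≤ n) {Ω : Set (Rn n)} (hΩ : IsOpen Ω)
    {u : Rn n → ℝ} (hc : ContinuousOn u Ω) (hu : LocallyConvexOn Ω u) {g : Fin n → Rn n → ℝ}
    {H : Fin n → Fin n → Rn n → ℝ} (hw : HasWeakDerivs Ω u g H) {p : ℝ} (hp : (n : ℝ) < p)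
    {q M : ℝ≥0∞} (hpq : ENNReal.ofReal p ≤ q) (hM : M ≠ ⊤)
    (hHM : ∀ i, eLpNorm (H i i) q (volume.restrict Ω) ≤ M) {x₀ : Rn n} (hx₀ : x₀ ∈ Ω) :
    DifferentiableAt ℝ u x₀ := by
  obtain ⟨r, hr, hball⟩ := Metric.nhds_basis_closedBall.mem_iff.1 (hΩ.mem_nhds hx₀)
  have hball' := Metric.ball_subset_closedBall.trans hball
  have hn1 : (1 : ℝ) ≤ n := by exact_mod_cast hn
  have hn0 : (0 : ℝ) < n := by linarith
  have hp0 : 0 < p := by linarith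
  obtain ⟨L, hL⟩ := (hu.convexOn hc (convex_ball x₀ r) hball').exists_subgradient
    Metric.isOpen_ball (hc.mono hball') (Metric.mem_ball_self hr)
  set D := (8 * n : ℝ) ^ n / volume.real (Metric.ball (0 : Rn n) 1) with hD
  have hD0 : 0 ≤ D := by positivity
  set F := ballNormBound n r p q M
  set β := 2 - n / p with hβ
  have hβ1 : 0 < β - 1 := by
    have : (n : ℝ) / p < 1 := (div_lt_one hp0).2 hp
    linarith
  have hest : ∀ y : Rn n, 0 < ‖y‖ → ‖y‖ < r / (4 * n) →
      u (x₀ + y) - u x₀ - L y ≤ 2 * (D ^ (1 / p) * F * (n * ‖y‖) ^ β) := by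
    intro y hy0 hy
    have hδ : 0 < n * ‖y‖ := by positivity
    have hyr : 4 * (n * ‖y‖) < r := by
      rw [lt_div_iff₀ (by positivity)] at hy; linarith
    have key := hw.sub_affine_le hn hc hu hr (by linarith) hpq hM hball hHM (a := u x₀ - L x₀)
      (L := L) (c := x₀) (e := stdVec ⟨0, hn⟩) (by simp [stdVec]) (m := 0) (h := 0) hδ
      (fun j hj z hz => by
        obtain rfl : j = 0 := by simpa using hj
        simp only [Int.cast_zero, zero_smul, add_zero]
        simp
        linarith)
      (fun x hx => by have := hL x hx; rw [map_sub] at this; linarith)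
      (fun j hj => by
        obtain rfl : j = 0 := by simpa using hj
        simp)
      (y := y) (by rw [mul_div_cancel_left₀ _ hn0.ne'])
    refine le_of_eq_of_le ?_ (key.trans_eq ?_)
    · rw [map_add]; ring
    · rw [← hD, Nat.cast_zero, mul_zero, mul_zero, zero_add, zero_add, mul_one,
        Real.div_rpow hD0 (by positivity), ← Real.rpow_natCast _ n, ← Real.rpow_mul hδ.le,
        hβ, Real.rpow_sub hδ, Real.rpow_two, mul_one_div]
      ring
  refine ⟨L, (hasFDerivAt_iff_isLittleO_nhds_zero).2 (Asymptotics.isLittleO_iff.2 fun κ hκ => ?_)⟩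
  have hlim : Filter.Tendsto (fun y : Rn n => 2 * (D ^ (1 / p) * F * (n : ℝ) ^ β) * ‖y‖ ^ (β - 1))
      (nhds 0) (nhds 0) := by
    have h1 := (Real.continuousAt_rpow_const 0 (β - 1) (Or.inr hβ1.le)).tendsto.comp
      (tendsto_norm_zero (E := Rn n))
    have := h1.const_mul (2 * (D ^ (1 / p) * F * (n : ℝ) ^ β))
    rwa [Real.zero_rpow hβ1.ne', mul_zero] at this
  filter_upwards [hlim.eventually_lt_const hκ,
    Metric.ball_mem_nhds (0 : Rn n) (show 0 < r / (4 * n) by positivity)] with y hy1 hy2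
  rcases eq_or_ne y 0 with rfl | hy0
  · simp
  have hypos : 0 < ‖y‖ := norm_pos_iff.2 hy0
  have hyr : ‖y‖ < r / (4 * n) := by simpa using hy2
  have hr4 : r / (4 * n) ≤ r := div_le_self hr.le (by linarith)
  have hnonneg : 0 ≤ u (x₀ + y) - u x₀ - L y := by
    have := hL (x₀ + y) (by simp; linarith)
    rw [add_sub_cancel_left] at this
    linarith
  rw [Real.norm_of_nonneg hnonneg]
  refine (hest y hypos hyr).trans ?_
  rw [Real.mul_rpow hn0.le hypos.le]
  have h2 : ‖y‖ ^ β = ‖y‖ ^ (β - 1) * ‖y‖ := by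
    rw [Real.rpow_sub hypos β, Real.rpow_one, div_mul_cancel₀ _ hypos.ne']
  rw [h2]
  have := mul_le_mul_of_nonneg_right hy1.le hypos.le
  linarith

theorem exists_hasWeakDerivs_of_w2pNorm_lt {n : ℕ} {Ω : Set (Rn n)} {p M : ℝ≥0∞} {u : Rn n → ℝ}
    (hM : w2pNorm Ω p u < M) : ∃ (g : Fin n → Rn n → ℝ) (h : Fin n → Fin n → Rn n → ℝ),
      HasWeakDerivs Ω u g h ∧ ∀ i, eLpNorm (h i i) p (volume.restrict Ω) ≤ M := by
  simp only [w2pNorm, iInf_lt_iff] at hM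
  obtain ⟨g, h, hw, hlt⟩ := hM
  refine ⟨g, h, hw, fun i => le_trans ?_ hlt.le⟩
  calc eLpNorm (h i i) p (volume.restrict Ω)
      ≤ ∑ j, eLpNorm (h i j) p (volume.restrict Ω) :=
        Finset.single_le_sum (f := fun j => eLpNorm (h i j) p (volume.restrict Ω))
          (fun _ _ => zero_le) (Finset.mem_univ i)
    _ ≤ ∑ i, ∑ j, eLpNorm (h i j) p (volume.restrict Ω) :=
        Finset.single_le_sum (f := fun i => ∑ j, eLpNorm (h i j) p (volume.restrict Ω))
          (fun _ _ => zero_le) (Finset.mem_univ i)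
    _ ≤ _ := le_add_self

theorem w2pNorm_lt_top {n : ℕ} {Ω : Set (Rn n)} {p : ℝ≥0∞} {u : Rn n → ℝ} (hu : MemW2p Ω p u) :
    w2pNorm Ω p u < ⊤ := by
  obtain ⟨g, h, hw, h0, h1, h2⟩ := hu
  simp only [w2pNorm, iInf_lt_iff]
  refine ⟨g, h, hw, ?_⟩
  refine ENNReal.add_lt_top.2 ⟨ENNReal.add_lt_top.2 ⟨h0.2, ?_⟩, ?_⟩
  · exact ENNReal.sum_lt_top.2 fun i _ => (h1 i).2
  · exact ENNReal.sum_lt_top.2 fun i _ => ENNReal.sum_lt_top.2 fun j _ => (h2 i j).2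

theorem MemW2p.differentiableAt {n : ℕ} (hn : 1 ≤ n) {Ω : Set (Rn n)} (hΩ : IsOpen Ω) {p : ℝ≥0∞}
    {u : Rn n → ℝ} (hc : ContinuousOn u Ω) (hu : LocallyConvexOn Ω u) (hp : (n : ℝ≥0∞) < p)
    (hW : MemW2p Ω p u) {x₀ : Rn n} (hx₀ : x₀ ∈ Ω) : DifferentiableAt ℝ u x₀ := by
  obtain ⟨p', hp', hpp'⟩ := ENNReal.lt_iff_exists_nnreal_btwn.1 hp
  obtain ⟨M, hM, hMtop⟩ := exists_between (w2pNorm_lt_top hW)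
  obtain ⟨g, h, hw, hh⟩ := exists_hasWeakDerivs_of_w2pNorm_lt hM
  exact hw.differentiableAt hn hΩ hc hu (p := p') (by exact_mod_cast hp')
    (by rw [ENNReal.ofReal_coe_nnreal]; exact hpp'.le) hMtop.ne hh hx₀

/-- Growth with `β = 2 - (n - 1) / P`: the number of averaging points is of order `ρ / δ`, which
saves one power of `δ` in the density bound. -/
theorem exists_sphereLowerBound_of_w2pNorm_le {n k : ℕ} (hk : 1 ≤ k) (hkn : k + 1 ≤ n)
    {μ : ℝ} (hμ : 0 < μ) {p : ℝ≥0∞} (hp : (n : ℝ≥0∞) < p)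
    (hexp : ENNReal.ofReal (((n : ℝ) - 1) * ((n : ℝ) - k) / 2) < p) {R ρ M : ℝ} (hρ : 0 < ρ)
    (hρR : ρ ≤ R / 4) : ∃ C : ℝ, 0 < C ∧
      ∀ (Ω : Set (Rn n)) (u : Rn n → ℝ) (x₀ : Rn n), IsBoundedDomain Ω →
        IsViscositySubsolution k Ω (fun _ => μ) u → MemW2p Ω p u →
        w2pNorm Ω p u ≤ ENNReal.ofReal M → Metric.ball x₀ R ⊆ Ω →
          SphereLowerBound u x₀ ρ C := by
  have hn : 1 ≤ n := by omega
  have hn1 : (1 : ℝ) ≤ n := by exact_mod_cast hn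
  have hn0 : (0 : ℝ) < n := by linarith
  -- Hölder's inequality needs a finite exponent, while `p` may be `∞`; the strict thresholds leave
  -- room for one.
  obtain ⟨p', hp', hpp'⟩ := ENNReal.lt_iff_exists_nnreal_btwn.1 (max_lt hp hexp)
  have hpn : (n : ℝ) < p' := by exact_mod_cast (le_max_left _ _).trans_lt hp'
  have hpe : ((n : ℝ) - 1) * ((n : ℝ) - k) / 2 < p' := by
    have := (le_max_right _ _).trans_lt hp'
    rwa [← ENNReal.ofReal_coe_nnreal, ENNReal.ofReal_lt_ofReal_iff (by linarith)] at this
  have hpp : ENNReal.ofReal p' ≤ p := by rw [ENNReal.ofReal_coe_nnreal]; exact hpp'.le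
  set P : ℝ := (p' : ℝ)
  have hP0 : 0 < P := by linarith
  have hR : 0 < R := by linarith
  set D := (8 * n : ℝ) ^ n / volume.real (Metric.ball (0 : Rn n) 1) with hD
  have hD0 : 0 ≤ D := by positivity
  -- The norm is an infimum, so weak derivatives are chosen under a strictly larger bound.
  set M' := ENNReal.ofReal M + 1 with hM'
  have hM'top : M' ≠ ⊤ := by simp [hM']
  set F := ballNormBound n (R / 2) P p M' with hF
  have hF0 : 0 ≤ F := ballNormBound_nonneg _ _ _ _ _
  set β : ℝ := 2 - (n - 1) / P with hβ
  set K := 5 + 2 * ((D / (ρ * n)) ^ (1 / P) * F * (n : ℝ) ^ β) with hK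
  have hK0 : 0 < K := by positivity
  have hj : (((n - 1 - k : ℕ) : ℝ)) = n - 1 - k := by
    rw [Nat.cast_sub (by omega), Nat.cast_sub hn, Nat.cast_one]
  obtain ⟨δ₀, hδ₀, hlt⟩ := exists_forall_lt_of_exponent (r := ρ / 4) (K := K) (β := β) hμ (n - 1 - k)
    (by
      rw [hj, hβ]
      have : ((n : ℝ) - 1) / P * (n - 1 - k + 1) < 2 := by
        rw [div_mul_eq_mul_div, div_lt_iff₀ hP0]; linarith
      linarith)
  obtain ⟨m, hm⟩ := exists_nat_gt (ρ / 2 / min δ₀ (R / (8 * n)))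
  have hmin : 0 < min δ₀ (R / (8 * n)) := lt_min hδ₀ (by positivity)
  have hm0 : (0 : ℝ) < m := lt_trans (by positivity) hm
  -- The averaging lemma is used at scale `n δ`, with spacing `δ / 2`. Then `m` steps cover exactly
  -- `ρ / 4`, and starting at distance `ρ / 2 + s` with `|s| ≤ ρ / 4` the points stay on the
  -- segment.
  set δ := ρ / 2 / m with hδ_def
  have hδ : 0 < δ := by positivity
  have hδmin : δ < min δ₀ (R / (8 * n)) := by
    rw [hδ_def, div_lt_iff₀ hm0, mul_comm]; exact (div_lt_iff₀ hmin).1 hm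
  have hδR : n * δ < R / 8 := by
    have := hδmin.trans_le (min_le_right _ _)
    rw [lt_div_iff₀ (by positivity)] at this
    linarith
  have hδnδ : δ ≤ n * δ := le_mul_of_one_le_left hδ.le hn1
  have hmδ : (m : ℝ) * (δ / 2) = ρ / 4 := by rw [hδ_def]; field_simp; norm_num
  have hη : n * δ / (2 * n) = δ / 2 := by field_simp
  refine ⟨δ ^ β, by positivity, fun Ω u x₀ hΩ hu hW hM hball => ?_⟩
  obtain ⟨g, H, hw, hH⟩ := exists_hasWeakDerivs_of_w2pNorm_lt (M := M')
    (hM.trans_lt (ENNReal.lt_add_right ENNReal.ofReal_ne_top one_ne_zero))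
  have hx₀ : x₀ ∈ Ω := hball (Metric.mem_ball_self hR)
  have hd := hW.differentiableAt hn hΩ.1 hu.1 hu.2.1 hp hx₀
  have hballR : Metric.closedBall x₀ (R / 2) ⊆ Ω :=
    (Metric.closedBall_subset_ball (by linarith)).trans hball
  have hconv := hu.2.1.convexOn hu.1 (convex_ball x₀ R) hball
  refine hu.sphereLowerBound_of_growth hk hkn hΩ hρ hρR hball hd hδ (by linarith)
    (N := K * δ ^ β) (by positivity) (hlt δ hδ (hδmin.trans_le (min_le_left _ _)))
    fun e he hseg s y hs hy => ?_
  have hs' := abs_le.1 hs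
  have hjρ : ∀ j ∈ Finset.Icc (-m : ℤ) m, |(j : ℝ) * (δ / 2)| ≤ ρ / 4 := fun j hj => by
    rw [abs_mul, abs_of_pos (show 0 < δ / 2 by positivity), ← hmδ]
    refine mul_le_mul_of_nonneg_right ?_ (by positivity)
    rw [Finset.mem_Icc] at hj
    rw [abs_le]
    exact ⟨by exact_mod_cast hj.1, by exact_mod_cast hj.2⟩
  have hpt : ∀ (t : ℝ) (z : Rn n), x₀ + (ρ / 2 + s) • e + t • e + z =
      x₀ + ((ρ / 2 + s + t) • e + z) := fun t z => by module
  have key := hw.sub_affine_le hn hu.1 hu.2.1 (r := R / 2) (p := P) (by positivity) (by linarith)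
    hpp hM'top hballR hH (a := u x₀ - fderiv ℝ u x₀ x₀) (L := fderiv ℝ u x₀)
    (c := x₀ + (ρ / 2 + s) • e) he (m := m) (δ := n * δ) (h := δ ^ β) (by positivity)
    (fun j hj z hz => by
      have h1 := abs_le.1 (hjρ j hj)
      rw [hη, smul_smul, hpt, Metric.mem_ball, dist_eq_norm, add_sub_cancel_left]
      refine (norm_add_le _ _).trans_lt ?_
      rw [norm_smul, he, mul_one, Real.norm_of_nonneg (by linarith)]
      linarith)
    (fun x hx => by
      have := hconv.add_fderiv_le Metric.isOpen_ball (hu.1.mono hball) (Metric.mem_ball_self hR) hd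
        (Metric.ball_subset_ball (by linarith) hx)
      rw [map_sub] at this
      linarith)
    (fun j hj => by
      have h1 := abs_le.1 (hjρ j hj)
      have h2 := hseg (ρ / 2 + s + j * (δ / 2)) (by linarith) (by linarith)
      have h3 := hpt (j * (δ / 2)) 0
      rw [add_zero, add_zero] at h3
      rw [hη, smul_smul, h3, map_add]
      linarith)
    (y := y) (by rwa [mul_div_cancel_left₀ _ hn0.ne'])
  have hA : (D / ((n * δ) ^ n * (2 * m + 1))) ^ (1 / P) * F * (n * δ) ^ 2 ≤
      (D / (ρ * n)) ^ (1 / P) * F * (n : ℝ) ^ β * δ ^ β := by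
    have hδ' : 0 < n * δ := by positivity
    -- Since `2 m δ = ρ`, the factor `2 m + 1` trades one power of `n δ` for `ρ n`.
    have h1 : ρ * n * (n * δ) ^ ((n : ℝ) - 1) ≤ (n * δ) ^ n * (2 * m + 1) := by
      rw [Real.rpow_sub hδ', Real.rpow_natCast, Real.rpow_one]
      have h2 : ρ * n * ((n * δ) ^ n / (n * δ)) = (n * δ) ^ n * (2 * m) := by
        rw [hδ_def]; field_simp
      rw [h2]
      gcongr
      linarith
    have h3 : (D / ((n * δ) ^ n * (2 * m + 1))) ^ (1 / P) ≤
        (D / (ρ * n)) ^ (1 / P) * ((n * δ) ^ (((n : ℝ) - 1) / P))⁻¹ := by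
      calc (D / ((n * δ) ^ n * (2 * m + 1))) ^ (1 / P)
          ≤ (D / (ρ * n * (n * δ) ^ ((n : ℝ) - 1))) ^ (1 / P) := by gcongr
        _ = _ := by
          rw [← div_div, Real.div_rpow (by positivity) (by positivity), ← Real.rpow_mul hδ'.le,
            mul_one_div, div_eq_mul_inv]
    calc _ ≤ (D / (ρ * n)) ^ (1 / P) * ((n * δ) ^ (((n : ℝ) - 1) / P))⁻¹ * F * (n * δ) ^ 2 := by
          gcongr
      _ = (D / (ρ * n)) ^ (1 / P) * F * (n * δ) ^ β := by
          rw [hβ, Real.rpow_sub hδ', Real.rpow_two, div_eq_mul_inv]; ring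
      _ = _ := by rw [Real.mul_rpow hn0.le hδ.le]; ring
  rw [map_add] at key
  rw [map_add]
  rw [map_add] at key
  have : K * δ ^ β = 5 * δ ^ β + 2 * ((D / (ρ * n)) ^ (1 / P) * F * (n : ℝ) ^ β * δ ^ β) := by
    rw [hK]; ring
  linarith

/-! ### The two cases together. -/

theorem lemma7p1 (n k : ℕ) (hn : 4 ≤ n) (hk : 1 ≤ k) (hkn : k ≤ n - 3) (μ : ℝ) (hμ : 0 < μ) :
    -- Case (1): `u ∈ C^{1,α}(Ω̄)` with `α > 1 - 2 / (n - k)`.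
    (∀ α : ℝ, 1 - 2 / ((n : ℝ) - (k : ℝ)) < α → α ≤ 1 →
      (∀ (Ω : Set (Rn n)) (u : Rn n → ℝ), IsBoundedDomain Ω →
        IsViscositySubsolution k Ω (fun _ => μ) u → MemC1Alpha Ω α u →
          StrictlyConvexGraph Ω u) ∧
      (∀ R ρ M : ℝ, 0 < ρ → ρ ≤ R / 4 → ∃ C : ℝ, 0 < C ∧
        ∀ (Ω : Set (Rn n)) (u : Rn n → ℝ) (x₀ : Rn n), IsBoundedDomain Ω →
          IsViscositySubsolution k Ω (fun _ => μ) u → MemC1Alpha Ω α u →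
          c1AlphaNorm Ω α u ≤ ENNReal.ofReal M → Metric.ball x₀ R ⊆ Ω →
            SphereLowerBound u x₀ ρ C)) ∧
    -- Case (2): `u ∈ W^{2,p}(Ω)` with `p > (n - 1) (n - k) / 2`.
    (∀ p : ENNReal, ENNReal.ofReal (((n : ℝ) - 1) * ((n : ℝ) - (k : ℝ)) / 2) < p →
      (∀ (Ω : Set (Rn n)) (u : Rn n → ℝ), IsBoundedDomain Ω →
        IsViscositySubsolution k Ω (fun _ => μ) u → MemW2p Ω p u →
          DifferentiableOn ℝ u Ω ∧ StrictlyConvexGraph Ω u) ∧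
      (∀ R ρ M : ℝ, 0 < ρ → ρ ≤ R / 4 → ∃ C : ℝ, 0 < C ∧
        ∀ (Ω : Set (Rn n)) (u : Rn n → ℝ) (x₀ : Rn n), IsBoundedDomain Ω →
          IsViscositySubsolution k Ω (fun _ => μ) u → MemW2p Ω p u →
          w2pNorm Ω p u ≤ ENNReal.ofReal M → Metric.ball x₀ R ⊆ Ω →
            SphereLowerBound u x₀ ρ C)) := by
  have hkn' : k + 1 ≤ n := by omega
  have hn1 : 1 ≤ n := by omega
  have hj : (((n - 1 - k : ℕ) : ℝ)) = n - 1 - k := by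
    rw [Nat.cast_sub (by omega), Nat.cast_sub hn1, Nat.cast_one]
  have hnk : (3 : ℝ) ≤ n - k := by
    have : k + 3 ≤ n := by omega
    have : (k : ℝ) + 3 ≤ n := by exact_mod_cast this
    linarith
  refine ⟨fun α hα hα1 => ?_, fun p hp => ?_⟩
  · have hα0 : 0 < α := by
      have : 2 / ((n : ℝ) - k) < 1 := by rw [div_lt_one (by linarith)]; linarith
      linarith
    have hexp : 2 * ((n - 1 - k : ℕ) : ℝ) < (1 + α) * ((n - 1 - k : ℕ) + 1) := by
      rw [hj]
      rw [sub_lt_comm, lt_div_iff₀ (by linarith)] at hα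
      linarith
    have hmain := fun R ρ M hρ hρR => exists_sphereLowerBound_of_c1AlphaNorm_le hk hkn' hμ hα0 hexp
      (R := R) (ρ := ρ) (M := M) hρ hρR
    have hdiff : ∀ (Ω : Set (Rn n)) (u : Rn n → ℝ), MemC1Alpha Ω α u → DifferentiableOn ℝ u Ω :=
      fun Ω u hu => hu.1.differentiableOn one_ne_zero
    refine ⟨fun Ω u hΩ hu hC => ?_, fun R ρ M hρ hρR => ?_⟩
    · refine strictlyConvexGraph_of_sphereLowerBound hΩ.1 hu.2.1 hu.1 fun x₀ R _ hball ρ hρ hρR => ?_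
      obtain ⟨C, hC0, h⟩ := hmain R ρ (c1AlphaNorm Ω α u).toReal hρ hρR
      exact ⟨C, hC0, h Ω u x₀ hΩ hu (hdiff Ω u hC) (ENNReal.ofReal_toReal hC.2.2.2.ne).ge hball⟩
    · obtain ⟨C, hC0, h⟩ := hmain R ρ M hρ hρR
      exact ⟨C, hC0, fun Ω u x₀ hΩ hu hC => h Ω u x₀ hΩ hu (hdiff Ω u hC)⟩
  -- As `n - k ≥ 3`, the threshold is at least `3 (n - 1) / 2`, which is at least `n` for `n ≥ 4`.
  · have hpn : (n : ℝ≥0∞) < p := by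
      refine lt_of_le_of_lt ?_ hp
      rw [← ENNReal.ofReal_natCast]
      refine ENNReal.ofReal_le_ofReal ?_
      have : (4 : ℝ) ≤ n := by exact_mod_cast hn
      nlinarith
    have hmain := fun R ρ M hρ hρR => exists_sphereLowerBound_of_w2pNorm_le hk hkn' hμ hpn hp
      (R := R) (ρ := ρ) (M := M) hρ hρR
    refine ⟨fun Ω u hΩ hu hW => ⟨fun x hx =>
      (hW.differentiableAt hn1 hΩ.1 hu.1 hu.2.1 hpn hx).differentiableWithinAt, ?_⟩, hmain⟩
    refine strictlyConvexGraph_of_sphereLowerBound hΩ.1 hu.2.1 hu.1 fun x₀ R _ hball ρ hρ hρR => ?_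
    obtain ⟨C, hC0, h⟩ := hmain R ρ (w2pNorm Ω p u).toReal hρ hρR
    exact ⟨C, hC0, h Ω u x₀ hΩ hu hW (ENNReal.ofReal_toReal (w2pNorm_lt_top hW).ne).ge hball⟩
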